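/- Let $n\ge 2$ and let $V$ denote $n$-dimensional Lebesgue measure (volume) in $\mathbb R^n$. Let $\Phi_2$ be the set of convex functions $\varphi:[0,\infty)^2\to[0,\infty)$ that are increasing (not necessarily strictly) in each variable and satisfy $\varphi(0,0)=0$ and $\varphi(1,0)=\varphi(0,1)=1$, and let $\Phi$ be the set of convex increasing functions $\psi:[0,\infty)\to[0,\infty)$ with $\psi(0)=0$ and $\psi(1)=1$. For $\varphi\in\Phi_2$ put $$J_\varphi=\{(x_1,x_2)\in[-1,1]^2:\varphi(|x_1|,|x_2|)\le 1\},$$ with polar set $J_\varphi^\circ=\{z\in\mathbb R^2: z\cdot w\le 1\text{ for all }w\in J_\varphi\}$. The Orlicz sum $K+_\varphi L$ of arbitrary sets $K,L\subset\mathbb R^n$ is defined as follows. If $J_\varphi^\circ=[-1,1]^2$, then $K+_\varphi L=\{x+y:x\in K,\ y\in L\}$. Otherwise there are $\psi_1,\psi_2\in\Phi$ such that $$J_\varphi^\circ\cap[0,\infty)^2=\{(x_1,x_2)\in[0,1]^2:\psi_1(x_1)+\psi_2(x_2)\le 1\}.$$ With $\tau_j=\max\{t\ge 0:\psi_j(t)=0\}<1$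 and $\widehat{\psi_j}:[\tau_j,1]\to[0,1]$ the (bijective) restriction of $\psi_j$ to $[\tau_j,1]$, one sets $$K+_\varphi L=\left\{\widehat{\psi_1}^{-1}(1-t)\,x+\widehat{\psi_2}^{-1}(t)\,y:\ x\in K,\ y\in L,\ 0\le t\le 1\right\},$$ which does not depend on the choice of $\psi_1,\psi_2$. Sets $K$ and $L$ are called dilatates of each other if $L=cK$ for some $c>0$. (a) (Orlicz–Brunn–Minkowski inequality) Let $\varphi\in\Phi_2$ and let $K,L\subset\mathbb R^n$ be compact sets with $V(K)V(L)>0$. Then $K+_\varphi L$ is a compact set of positive volume, and $$1\ \ge\ \varphi\left(\left(\frac{V(K)}{V(K+_\varphi L)}\right)^{1/n},\left(\frac{V(L)}{V(K+_\varphi L)}\right)^{1/n}\right).$$ When $\varphi$ is strictly convex, equality holds if and only if $K$ and $L$ are convex, contain the origin, and are dilatates of each other. (b) (The $L_p$ case) Let $1<p<\infty$ and $1/p+1/p'=1$. Then $\varphi(x_1,x_2)=x_1^p+x_2^p$ belongs to $\Phi_2$, and for all nonempty compact sets $K,L\subset\mathbb R^n$ the sum $K+_\varphi L$ equals the $L_p$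 sum $$K+_pL=\left\{(1-t)^{1/p'}x+t^{1/p'}y:\ x\in K,\ y\in L,\ 0\le t\le 1\right\},$$ and $$V(K+_pL)^{p/n}\ \ge\ V(K)^{p/n}+V(L)^{p/n}.$$ If $V(K)V(L)>0$, then equality holds if and only if $K$ and $L$ are convex, contain the origin, and are dilatates of each other. -/

import Mathlib

open MeasureTheory Set
open scoped Pointwise

namespace OrliczBM

/-- The closed quadrant `[0,∞)²`. -/
def quadrant : Set (ℝ × ℝ) := {z | 0 ≤ z.1 ∧ 0 ≤ z.2}

/-- The class `Φ₂` of convex functions `φ : [0,∞)² → [0,∞)` that are increasing (in the weak sense)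
in each variable and satisfy `φ(0,0) = 0`, `φ(1,0) = φ(0,1) = 1`. A function on `[0,∞)²` is
represented by a function on `ℝ × ℝ`, of which only the values on the quadrant matter. -/
structure IsPhiTwo (φ : ℝ × ℝ → ℝ) : Prop where
  convex : ConvexOn ℝ quadrant φ
  nonneg : ∀ z ∈ quadrant, 0 ≤ φ z
  mono_left : ∀ x x' y : ℝ, 0 ≤ x → x ≤ x' → 0 ≤ y → φ (x, y) ≤ φ (x', y)
  mono_right : ∀ x y y' : ℝ, 0 ≤ x → 0 ≤ y → y ≤ y' → φ (x, y) ≤ φ (x, y')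
  map_zero : φ (0, 0) = 0
  map_left : φ (1, 0) = 1
  map_right : φ (0, 1) = 1

/-- The class `Φ = Φ₁` of convex increasing functions `ψ : [0,∞) → [0,∞)` with `ψ(0) = 0` and
`ψ(1) = 1`; only the values on `[0,∞)` matter. -/
structure IsPhiOne (ψ : ℝ → ℝ) : Prop where
  convex : ConvexOn ℝ (Ici 0) ψ
  nonneg : ∀ s, 0 ≤ s → 0 ≤ ψ s
  mono : MonotoneOn ψ (Ici 0)
  map_zero : ψ 0 = 0
  map_one : ψ 1 = 1

/-- The convex body `J_φ = {(x₁, x₂) ∈ [-1,1]² : φ(|x₁|, |x₂|) ≤ 1}`. -/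
def J (φ : ℝ × ℝ → ℝ) : Set (ℝ × ℝ) :=
  {z | |z.1| ≤ 1 ∧ |z.2| ≤ 1 ∧ φ (|z.1|, |z.2|) ≤ 1}

/-- The polar set of a planar set. -/
def polarSet (A : Set (ℝ × ℝ)) : Set (ℝ × ℝ) :=
  {z | ∀ w ∈ A, z.1 * w.1 + z.2 * w.2 ≤ 1}

/-- The square `[-1,1]²`. -/
def square : Set (ℝ × ℝ) := Icc (-1) 1 ×ˢ Icc (-1) 1

/-- `ψ₁, ψ₂ ∈ Φ` satisfy
`J_φ° ∩ [0,∞)² = {(x₁, x₂) ∈ [0,1]² : ψ₁(x₁) + ψ₂(x₂) ≤ 1}`. -/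
def Represents (φ : ℝ × ℝ → ℝ) (ψ₁ ψ₂ : ℝ → ℝ) : Prop :=
  IsPhiOne ψ₁ ∧ IsPhiOne ψ₂ ∧
    polarSet (J φ) ∩ quadrant =
      {z | z ∈ Icc (0 : ℝ) 1 ×ˢ Icc (0 : ℝ) 1 ∧ ψ₁ z.1 + ψ₂ z.2 ≤ 1}

/-- `τ(ψ) = max {t ≥ 0 : ψ(t) = 0}`; for `ψ ∈ Φ` the maximum exists and is smaller than `1`. -/
noncomputable def tau (ψ : ℝ → ℝ) : ℝ := sSup {t | 0 ≤ t ∧ ψ t = 0}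

/-- The inverse of the restriction of `ψ` to `[τ(ψ), 1]`, which, for `ψ ∈ Φ`, is a bijection
onto `[0,1]`. Only its values on `[0,1]` are used. -/
noncomputable def hatInv (ψ : ℝ → ℝ) : ℝ → ℝ := Function.invFunOn ψ (Icc (tau ψ) 1)

variable {n : ℕ}

/-- `{ψ̂₁⁻¹(1 - t) x + ψ̂₂⁻¹(t) y : x ∈ K, y ∈ L, 0 ≤ t ≤ 1}`. -/
def sumVia (ψ₁ ψ₂ : ℝ → ℝ) (K L : Set (EuclideanSpace ℝ (Fin n))) :
    Set (EuclideanSpace ℝ (Fin n)) :=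
  {z | ∃ x ∈ K, ∃ y ∈ L, ∃ t ∈ Icc (0 : ℝ) 1,
    z = hatInv ψ₁ (1 - t) • x + hatInv ψ₂ t • y}

open Classical in
/-- The Orlicz sum `K +_φ L` of two arbitrary sets: the Minkowski sum if `J_φ° = [-1,1]²`, and
`{ψ̂₁⁻¹(1 - t) x + ψ̂₂⁻¹(t) y : x ∈ K, y ∈ L, 0 ≤ t ≤ 1}` otherwise, where `ψ₁, ψ₂ ∈ Φ` is any
pair representing `J_φ°`. (For `φ ∈ Φ₂` with `J_φ° ≠ [-1,1]²` such a pair exists and the set does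
not depend on it, so the last branch is not reached.) -/
noncomputable def orliczSum (φ : ℝ × ℝ → ℝ) (K L : Set (EuclideanSpace ℝ (Fin n))) :
    Set (EuclideanSpace ℝ (Fin n)) :=
  if polarSet (J φ) = square then K + L
  else if h : ∃ ψ : (ℝ → ℝ) × (ℝ → ℝ), Represents φ ψ.1 ψ.2 then
    sumVia h.choose.1 h.choose.2 K L
  else ∅

/-- The `L_p` sum of two arbitrary sets,
`{(1 - t)^(1/p') x + t^(1/p') y : x ∈ K, y ∈ L, 0 ≤ t ≤ 1}`, where `1/p + 1/p' = 1`. -/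
def lpSum (p : ℝ) (K L : Set (EuclideanSpace ℝ (Fin n))) : Set (EuclideanSpace ℝ (Fin n)) :=
  {z | ∃ x ∈ K, ∃ y ∈ L, ∃ t ∈ Icc (0 : ℝ) 1,
    z = (1 - t) ^ (1 / p.conjExponent) • x + t ^ (1 / p.conjExponent) • y}

/-- The function `φ(x₁, x₂) = x₁^p + x₂^p`. -/
noncomputable def powPhi (p : ℝ) (z : ℝ × ℝ) : ℝ := z.1 ^ p + z.2 ^ p

/-- The volume `V(K)`, that is, the `n`-dimensional Lebesgue measure of `K`. -/
noncomputable def V (K : Set (EuclideanSpace ℝ (Fin n))) : ℝ := (volume K).toReal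

/-- `K` and `L` are convex, contain the origin, and are dilatates of each other. -/
def IsConvexZeroDilatates (K L : Set (EuclideanSpace ℝ (Fin n))) : Prop :=
  Convex ℝ K ∧ Convex ℝ L ∧ 0 ∈ K ∧ 0 ∈ L ∧ ∃ c : ℝ, 0 < c ∧ L = c • K

end OrliczBM

/-!
The proof rests on a description of the Orlicz sum that does not mention the representing functions.
Let `M` be the part of the polar set of `J φ` in the quadrant (`polarQuadrant`). The coefficient
pairs `(a, b)` in the definition of `K +_φ L` run exactly through the maximal points of `M` for the
componentwise order (`upperArc`), so `K +_φ L` is the union of the sets `a K + b L` over this compact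
arc (`IsPhiTwo.orliczSum_eq`).

Write `k`, `l`, `s` for the `n`-th roots of the volumes of `K`, `L`, `K +_φ L`. The Brunn–Minkowski
inequality gives `s ≥ a k + b l` for each point of the arc, that is, `(k / s, l / s)` pairs to at
most `1` with every point of `M`; by the bipolar theorem for the closed convex set `J φ` this says
`φ (k / s, l / s) ≤ 1`. Moreover `φ (k / s, l / s) = 1` exactly if `s` is the maximum of `a k + b l`.

For convex dilatates containing the origin, all `a K + b L` are multiples of `K`, whence equality.
Conversely, suppose equality holds and `φ` is strictly convex. At the maximizing pair `(a₀, b₀)` the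
Brunn–Minkowski inequality is an equality, which makes `K` and `L` convex, and every `a K + b L` is
contained in `a₀ K + b₀ L`. Comparing support functions, `(a₀, b₀)` maximizes on the arc the pairing
with `(h_K(f), h_L(f))` for every functional `f`. Strict convexity of `φ` allows only one such
direction (`IsPhiTwo.eq_of_pairing_eq_one`), so `(h_K(f), h_L(f))` is a nonnegative multiple of
`(k, l)`; hence `L = (l / k) K` and both sets contain the origin.

The Brunn–Minkowski inequality (`brunnMinkowski`) is obtained from the Prékopa–Leindler inequality on
the line by induction on the dimension. That equality forces convexity
(`IsBrunnMinkowskiEq.convex_left`) comes from cutting both sets in the same volume ratio by parallel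
hyperplanes: equality is inherited by the pieces, and an empty slab between two pieces of positive
volume would produce additional volume in the sum.
-/

open scoped ENNReal Topology

namespace OrliczBM

/-! ### The Brunn–Minkowski inequality -/

theorem volume_add_volume_le_of_isCompact_real {F G : Set ℝ} (hF : IsCompact F) (hG : IsCompact G)
    (hF' : F.Nonempty) (hG' : G.Nonempty) : volume F + volume G ≤ volume (F + G) := by
  obtain ⟨u, huF, hu⟩ := hF.exists_isMaxOn hF' continuousOn_id
  obtain ⟨v, hvG, hv⟩ := hG.exists_isMinOn hG' continuousOn_id
  have hsub : (F + {v}) ∪ ({u} + G) ⊆ F + G :=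
    union_subset (add_subset_add_left (by simpa using hvG))
      (add_subset_add_right (by simpa using huF))
  have hinter : (F + {v}) ∩ ({u} + G) ⊆ {u + v} := by
    rintro z ⟨⟨x, hx, y, hy, rfl⟩, ⟨x', hx', y', hy', hz⟩⟩
    simp only [mem_singleton_iff] at hy hx' ⊢
    subst hy hx'
    have h1 : x ≤ x' := hu hx
    have h2 : y ≤ y' := hv hy'
    simp only at hz ⊢
    linarith
  have hd : AEDisjoint volume (F + {v}) ({u} + G) :=
    measure_mono_null hinter (by simp)
  calc volume F + volume G = volume (F + {v}) + volume ({u} + G) := by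
        rw [add_singleton, singleton_add, image_add_right, image_add_left,
          measure_preimage_add_right, measure_preimage_add]
    _ = volume ((F + {v}) ∪ ({u} + G)) :=
        (measure_union₀' ((hF.add isCompact_singleton).measurableSet.nullMeasurableSet) hd).symm
    _ ≤ _ := measure_mono hsub

/-- The one-dimensional Brunn–Minkowski inequality for convex combinations of Borel sets. -/
theorem volume_smul_add_le_real {F G : Set ℝ} (hF : MeasurableSet F) (hG : MeasurableSet G)
    (hF' : F.Nonempty) (hG' : G.Nonempty) {a b : ℝ} (ha : 0 ≤ a) (hb : 0 ≤ b) :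
    ENNReal.ofReal a * volume F + ENNReal.ofReal b * volume G ≤ volume (a • F + b • G) := by
  obtain ⟨u, hu⟩ := hF'
  obtain ⟨v, hv⟩ := hG'
  rw [hF.measure_eq_iSup_isCompact, hG.measure_eq_iSup_isCompact]
  simp_rw [ENNReal.mul_iSup, iSup_and']
  refine ENNReal.biSup_add_biSup_le' ⟨∅, empty_subset _, isCompact_empty⟩
    ⟨∅, empty_subset _, isCompact_empty⟩ fun A hA B hB => ?_
  have hvol : ∀ (r : ℝ) (hr : 0 ≤ r) (S : Set ℝ) (x : ℝ),
      ENNReal.ofReal r * volume S ≤ volume (r • insert x S) := fun r hr S x => by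
    rw [Measure.addHaar_smul_of_nonneg volume hr]
    simp only [Module.finrank_self, pow_one]
    gcongr
    exact subset_insert x S
  have hAc := hA.2.insert u
  have hBc := hB.2.insert v
  calc _ ≤ volume (a • insert u A) + volume (b • insert v B) :=
        add_le_add (hvol a ha A u) (hvol b hb B v)
    _ ≤ volume (a • insert u A + b • insert v B) :=
        volume_add_volume_le_of_isCompact_real (hAc.smul a) (hBc.smul b)
          ((insert_nonempty u A).smul_set) ((insert_nonempty v B).smul_set)
    _ ≤ _ := by
        gcongr
        · exact insert_subset hu hA.1
        · exact insert_subset hv hB.1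

/-- Layer-cake formula for finite extended nonnegative functions. -/
theorem lintegral_eq_lintegral_meas_ofReal_lt {f : ℝ → ℝ≥0∞} (hf : Measurable f)
    (hfin : ∀ x, f x ≠ ∞) :
    ∫⁻ x, f x = ∫⁻ t in Ioi (0 : ℝ), volume {x | ENNReal.ofReal t < f x} := by
  calc ∫⁻ x, f x = ∫⁻ x, ENNReal.ofReal (f x).toReal := by
        simp_rw [ENNReal.ofReal_toReal (hfin _)]
    _ = ∫⁻ t in Ioi (0 : ℝ), volume {x | t < (f x).toReal} :=
        lintegral_eq_lintegral_meas_lt _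
          (Filter.Eventually.of_forall fun x => ENNReal.toReal_nonneg)
          hf.ennreal_toReal.aemeasurable
    _ = _ := by
        refine setLIntegral_congr_fun measurableSet_Ioi fun t ht => ?_
        simp_rw [ENNReal.ofReal_lt_iff_lt_toReal (le_of_lt ht) (hfin _)]

theorem ennreal_geom_mean_le_arith_mean {a b : ℝ} (ha : 0 < a) (hb : 0 < b) (hab : a + b = 1)
    (x y : ℝ≥0∞) : x ^ a * y ^ b ≤ ENNReal.ofReal a * x + ENNReal.ofReal b * y := by
  have ha' : ENNReal.ofReal a ≠ 0 := by simpa using ha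
  have hb' : ENNReal.ofReal b ≠ 0 := by simpa using hb
  rcases eq_or_ne x ∞ with rfl | hx
  · simp [ENNReal.mul_top ha']
  rcases eq_or_ne y ∞ with rfl | hy
  · simp [ENNReal.mul_top hb']
  lift x to NNReal using hx
  lift y to NNReal using hy
  rw [← ENNReal.coe_rpow_of_nonneg _ ha.le, ← ENNReal.coe_rpow_of_nonneg _ hb.le]
  have := NNReal.geom_mean_le_arith_mean2_weighted ⟨a, ha.le⟩ ⟨b, hb.le⟩ x y (NNReal.eq hab)
  rw [ENNReal.ofReal_eq_coe_nnreal ha.le, ENNReal.ofReal_eq_coe_nnreal hb.le]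
  exact_mod_cast this

/-- For two functions with supremum `1`, the Prékopa–Leindler hypothesis gives an arithmetic-mean
bound: the superlevel sets satisfy the one-dimensional Brunn–Minkowski inequality. -/
theorem lintegral_add_le_of_sup_eq_one {f g h : ℝ → ℝ≥0∞} (hf : Measurable f) (hg : Measurable g)
    (hh : Measurable h) {a b : ℝ} (ha : 0 < a) (hb : 0 < b) (hab : a + b = 1)
    (hf1 : ⨆ x, f x = 1) (hg1 : ⨆ x, g x = 1)
    (hfg : ∀ x y, f x ^ a * g y ^ b ≤ h (a * x + b * y)) :
    ENNReal.ofReal a * (∫⁻ x, f x) + ENNReal.ofReal b * (∫⁻ x, g x) ≤ ∫⁻ x, h x := by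
  have hfle : ∀ x, f x ≤ 1 := fun x => hf1 ▸ le_iSup f x
  have hgle : ∀ x, g x ≤ 1 := fun x => hg1 ▸ le_iSup g x
  have hmin : ∀ x, min (h x) 1 ≠ ∞ := fun x => ((min_le_right _ _).trans_lt ENNReal.one_lt_top).ne
  calc ENNReal.ofReal a * (∫⁻ x, f x) + ENNReal.ofReal b * (∫⁻ x, g x)
      = ∫⁻ t in Ioi (0 : ℝ), (ENNReal.ofReal a * volume {x | ENNReal.ofReal t < f x} +
          ENNReal.ofReal b * volume {x | ENNReal.ofReal t < g x}) := by
        have hm : ∀ k : ℝ → ℝ≥0∞, Measurable fun t : ℝ => volume {x | ENNReal.ofReal t < k x} :=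
          fun k => Antitone.measurable fun s t hst => measure_mono fun x hx =>
            (ENNReal.ofReal_le_ofReal hst).trans_lt hx
        rw [lintegral_add_left ((hm f).const_mul _), lintegral_const_mul _ (hm f),
          lintegral_const_mul _ (hm g),
          lintegral_eq_lintegral_meas_ofReal_lt hf
            fun x => ((hfle x).trans_lt ENNReal.one_lt_top).ne,
          lintegral_eq_lintegral_meas_ofReal_lt hg
            fun x => ((hgle x).trans_lt ENNReal.one_lt_top).ne]
    _ ≤ ∫⁻ t in Ioi (0 : ℝ), volume {x | ENNReal.ofReal t < min (h x) 1} := by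
        refine setLIntegral_mono' measurableSet_Ioi fun t ht => ?_
        rcases le_or_gt 1 t with h1t | ht1
        · have hemp : ∀ k : ℝ → ℝ≥0∞, (∀ x, k x ≤ 1) → {x | ENNReal.ofReal t < k x} = ∅ :=
            fun k hk => eq_empty_of_forall_notMem fun x hx =>
              absurd (hx.trans_le (hk x)) (by simpa using h1t)
          simp [hemp f hfle, hemp g hgle]
        · have ht1' : ENNReal.ofReal t < 1 := by simpa using ht1
          obtain ⟨x₀, hx₀⟩ := lt_iSup_iff.1 (hf1 ▸ ht1')
          obtain ⟨y₀, hy₀⟩ := lt_iSup_iff.1 (hg1 ▸ ht1')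
          refine (volume_smul_add_le_real (measurableSet_lt measurable_const hf)
            (measurableSet_lt measurable_const hg) ⟨x₀, hx₀⟩ ⟨y₀, hy₀⟩ ha.le hb.le).trans
            (measure_mono ?_)
          rintro _ ⟨_, ⟨x, hx, rfl⟩, _, ⟨y, hy, rfl⟩, rfl⟩
          refine lt_min (lt_of_lt_of_le ?_ (hfg x y)) ht1'
          have ht0 : ENNReal.ofReal t ≠ 0 := by simpa using ht
          calc ENNReal.ofReal t = ENNReal.ofReal t ^ a * ENNReal.ofReal t ^ b := by
                rw [← ENNReal.rpow_add a b ht0 ENNReal.ofReal_ne_top, hab, ENNReal.rpow_one]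
            _ < f x ^ a * g y ^ b :=
                ENNReal.mul_lt_mul (ENNReal.rpow_lt_rpow hx ha) (ENNReal.rpow_lt_rpow hy hb)
    _ = ∫⁻ x, min (h x) 1 :=
        (lintegral_eq_lintegral_meas_ofReal_lt (hh.min measurable_const) hmin).symm
    _ ≤ ∫⁻ x, h x := lintegral_mono fun x => min_le_left _ _

/-- The Prékopa–Leindler inequality on the line, for bounded functions. -/
theorem prekopaLeindler_real {f g h : ℝ → ℝ≥0∞} (hf : Measurable f) (hg : Measurable g)
    (hh : Measurable h) {a b : ℝ} (ha : 0 < a) (hb : 0 < b) (hab : a + b = 1)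
    (hf1 : ⨆ x, f x ≠ ∞) (hg1 : ⨆ x, g x ≠ ∞)
    (hfg : ∀ x y, f x ^ a * g y ^ b ≤ h (a * x + b * y)) :
    (∫⁻ x, f x) ^ a * (∫⁻ x, g x) ^ b ≤ ∫⁻ x, h x := by
  set M := ⨆ x, f x with hM
  set N := ⨆ x, g x with hN
  rcases eq_or_ne M 0 with hM0 | hM0
  · have : f = fun _ => 0 := funext fun x => le_antisymm (hM0 ▸ le_iSup f x) (zero_le)
    simp [this, ENNReal.zero_rpow_of_pos ha]
  rcases eq_or_ne N 0 with hN0 | hN0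
  · have : g = fun _ => 0 := funext fun x => le_antisymm (hN0 ▸ le_iSup g x) (zero_le)
    simp [this, ENNReal.zero_rpow_of_pos hb]
  have hP0 : M ^ a * N ^ b ≠ 0 := mul_ne_zero
    (by simp [ENNReal.rpow_eq_zero_iff, hM0, hf1]) (by simp [ENNReal.rpow_eq_zero_iff, hN0, hg1])
  have hPt : M ^ a * N ^ b ≠ ∞ := ENNReal.mul_ne_top
    (ENNReal.rpow_ne_top_of_nonneg ha.le hf1) (ENNReal.rpow_ne_top_of_nonneg hb.le hg1)
  have key := lintegral_add_le_of_sup_eq_one (f := fun x => M⁻¹ * f x) (g := fun x => N⁻¹ * g x)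
    (h := fun x => (M ^ a * N ^ b)⁻¹ * h x) (hf.const_mul _) (hg.const_mul _) (hh.const_mul _)
    ha hb hab (by rw [← ENNReal.mul_iSup, ← hM, ENNReal.inv_mul_cancel hM0 hf1])
    (by rw [← ENNReal.mul_iSup, ← hN, ENNReal.inv_mul_cancel hN0 hg1]) (fun x y => by
      rw [ENNReal.mul_rpow_of_nonneg _ _ ha.le, ENNReal.mul_rpow_of_nonneg _ _ hb.le,
        ENNReal.mul_inv (Or.inr (ENNReal.rpow_ne_top_of_nonneg hb.le hg1))
          (Or.inl (ENNReal.rpow_ne_top_of_nonneg ha.le hf1)), ENNReal.inv_rpow, ENNReal.inv_rpow,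
        mul_mul_mul_comm]
      gcongr
      exact hfg x y)
  rw [lintegral_const_mul _ hf, lintegral_const_mul _ hg, lintegral_const_mul _ hh] at key
  have key2 := (ennreal_geom_mean_le_arith_mean ha hb hab _ _).trans key
  rw [ENNReal.mul_rpow_of_nonneg _ _ ha.le, ENNReal.mul_rpow_of_nonneg _ _ hb.le,
    mul_mul_mul_comm, ENNReal.inv_rpow, ENNReal.inv_rpow,
    ← ENNReal.mul_inv (Or.inr (ENNReal.rpow_ne_top_of_nonneg hb.le hg1))
          (Or.inl (ENNReal.rpow_ne_top_of_nonneg ha.le hf1))] at key2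
  exact (ENNReal.mul_le_mul_iff_right (ENNReal.inv_ne_zero.2 hPt) (ENNReal.inv_ne_top.2 hP0)).1 key2

theorem isCompact_preimage_cons {n : ℕ} {A : Set (Fin (n + 1) → ℝ)} (hA : IsCompact A) (s : ℝ) :
    IsCompact {y : Fin n → ℝ | Fin.cons s y ∈ A} := by
  have : {y : Fin n → ℝ | Fin.cons s y ∈ A} ⊆ (fun x => Fin.tail x) '' A :=
    fun y hy => ⟨_, hy, Fin.tail_cons _ _⟩
  refine (hA.image (by unfold Fin.tail; fun_prop)).of_isClosed_subset ?_ this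
  exact hA.isClosed.preimage (by fun_prop)

theorem measurable_volume_cons {n : ℕ} {A : Set (Fin (n + 1) → ℝ)} (hA : MeasurableSet A) :
    Measurable fun s : ℝ => volume {y : Fin n → ℝ | Fin.cons s y ∈ A} := by
  have := measurable_measure_prodMk_left (ν := (volume : Measure (Fin n → ℝ)))
    ((MeasurableEquiv.piFinSuccAbove (fun _ : Fin (n + 1) => ℝ) 0).symm.measurable hA)
  simpa [MeasurableEquiv.piFinSuccAbove_symm_apply, preimage] using! this

theorem volume_eq_lintegral_cons {n : ℕ} {A : Set (Fin (n + 1) → ℝ)} (hA : MeasurableSet A) :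
    volume A = ∫⁻ s : ℝ, volume {y : Fin n → ℝ | Fin.cons s y ∈ A} := by
  have h1 := (volume_preserving_piFinSuccAbove (fun _ : Fin (n + 1) => ℝ) 0).symm
  rw [← h1.measure_preimage hA.nullMeasurableSet, Measure.volume_eq_prod, Measure.prod_apply
    ((MeasurableEquiv.piFinSuccAbove (fun _ : Fin (n + 1) => ℝ) 0).symm.measurable hA)]
  simp [MeasurableEquiv.piFinSuccAbove_symm_apply, preimage, Fin.consEquiv]

/-- The multiplicative form of the Brunn–Minkowski inequality. -/
theorem volume_rpow_mul_volume_rpow_le (n : ℕ) {A B : Set (Fin n → ℝ)} (hA : IsCompact A)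
    (hB : IsCompact B) {a b : ℝ} (ha : 0 < a) (hb : 0 < b) (hab : a + b = 1) :
    volume A ^ a * volume B ^ b ≤ volume (a • A + b • B) := by
  induction n with
  | zero =>
    rcases A.eq_empty_or_nonempty with rfl | ⟨x, hx⟩
    · simp [ENNReal.zero_rpow_of_pos ha]
    rcases B.eq_empty_or_nonempty with rfl | ⟨y, hy⟩
    · simp [ENNReal.zero_rpow_of_pos hb]
    have h1 : ∀ S : Set (Fin 0 → ℝ), S.Nonempty → S = univ := fun S hS => hS.eq_univ
    have hne : (a • A + b • B).Nonempty :=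
      Set.Nonempty.add (Set.Nonempty.smul_set ⟨x, hx⟩) (Set.Nonempty.smul_set ⟨y, hy⟩)
    rw [h1 A ⟨x, hx⟩, h1 B ⟨y, hy⟩] at *
    rw [h1 _ hne]
    simp [volume_pi]
  | succ n ih =>
    have hC : IsCompact (a • A + b • B) := (hA.smul a).add (hB.smul b)
    rw [volume_eq_lintegral_cons hA.measurableSet, volume_eq_lintegral_cons hB.measurableSet,
      volume_eq_lintegral_cons hC.measurableSet]
    have hbd : ∀ {S : Set (Fin (n + 1) → ℝ)}, IsCompact S →
        ⨆ s : ℝ, volume {y : Fin n → ℝ | Fin.cons s y ∈ S} ≠ ∞ := fun {S} hS => by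
      have hK : IsCompact ((fun x => Fin.tail x) '' S : Set (Fin n → ℝ)) :=
        hS.image (by unfold Fin.tail; fun_prop)
      refine ((iSup_le fun s => measure_mono fun y hy => ?_).trans_lt hK.measure_lt_top).ne
      exact ⟨_, hy, Fin.tail_cons _ _⟩
    refine prekopaLeindler_real (measurable_volume_cons hA.measurableSet)
      (measurable_volume_cons hB.measurableSet) (measurable_volume_cons hC.measurableSet)
      ha hb hab (hbd hA) (hbd hB) fun s t => ?_
    refine (ih (isCompact_preimage_cons hA s) (isCompact_preimage_cons hB t)).trans
      (measure_mono ?_)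
    rintro _ ⟨_, ⟨x, hx, rfl⟩, _, ⟨y, hy, rfl⟩, rfl⟩
    refine ⟨_, ⟨_, hx, rfl⟩, _, ⟨_, hy, rfl⟩, ?_⟩
    ext i
    refine Fin.cases ?_ (fun j => ?_) i <;> simp

variable {n : ℕ}

theorem V_smul {c : ℝ} (hc : 0 ≤ c) (A : Set (EuclideanSpace ℝ (Fin n))) :
    V (c • A) = c ^ n * V A := by
  unfold V
  rw [Measure.addHaar_smul_of_nonneg volume hc, ENNReal.toReal_mul,
    ENNReal.toReal_ofReal (pow_nonneg hc _), finrank_euclideanSpace_fin]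

theorem V_mono {A B : Set (EuclideanSpace ℝ (Fin n))} (hB : IsCompact B) (h : A ⊆ B) :
    V A ≤ V B :=
  ENNReal.toReal_mono hB.measure_lt_top.ne (measure_mono h)

theorem V_nonneg (A : Set (EuclideanSpace ℝ (Fin n))) : 0 ≤ V A := ENNReal.toReal_nonneg

theorem V_rpow_mul_V_rpow_le {A B : Set (EuclideanSpace ℝ (Fin n))} (hA : IsCompact A)
    (hB : IsCompact B) {a b : ℝ} (ha : 0 < a) (hb : 0 < b) (hab : a + b = 1) :
    V A ^ a * V B ^ b ≤ V (a • A + b • B) := by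
  have hvol : ∀ S : Set (EuclideanSpace ℝ (Fin n)), IsCompact S →
      volume (WithLp.ofLp '' S) = volume S := fun S hS => by
    have h := (PiLp.volume_preserving_toLp (Fin n)).measure_preimage hS.measurableSet.nullMeasurableSet
    rw [← h]
    congr 1
    ext x
    constructor
    · rintro ⟨y, hy, rfl⟩
      simpa using hy
    · intro hx
      exact ⟨_, hx, rfl⟩
  have hcont : Continuous (WithLp.ofLp : EuclideanSpace ℝ (Fin n) → (Fin n → ℝ)) :=
    PiLp.continuous_ofLp 2 _
  have h := volume_rpow_mul_volume_rpow_le n (hA.image hcont) (hB.image hcont) ha hb hab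
  have hC : IsCompact (a • A + b • B) := (hA.smul a).add (hB.smul b)
  have himg : a • (WithLp.ofLp '' A) + b • (WithLp.ofLp '' B) = WithLp.ofLp '' (a • A + b • B) := by
    ext z
    constructor
    · rintro ⟨_, ⟨_, ⟨x, hx, rfl⟩, rfl⟩, _, ⟨_, ⟨y, hy, rfl⟩, rfl⟩, rfl⟩
      exact ⟨a • x + b • y, ⟨_, ⟨x, hx, rfl⟩, _, ⟨y, hy, rfl⟩, rfl⟩, rfl⟩
    · rintro ⟨_, ⟨_, ⟨x, hx, rfl⟩, _, ⟨y, hy, rfl⟩, rfl⟩, rfl⟩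
      exact ⟨_, ⟨_, ⟨x, hx, rfl⟩, rfl⟩, _, ⟨_, ⟨y, hy, rfl⟩, rfl⟩, rfl⟩
  rw [himg, hvol A hA, hvol B hB, hvol _ hC] at h
  unfold V
  rw [ENNReal.toReal_rpow, ENNReal.toReal_rpow, ← ENNReal.toReal_mul]
  exact ENNReal.toReal_mono hC.measure_lt_top.ne h

/-- The Brunn–Minkowski inequality for nonempty compact sets. -/
theorem brunnMinkowski (hn : n ≠ 0) {A B : Set (EuclideanSpace ℝ (Fin n))} (hA : IsCompact A)
    (hB : IsCompact B) (hA' : A.Nonempty) (hB' : B.Nonempty) :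
    V A ^ (1 / (n : ℝ)) + V B ^ (1 / (n : ℝ)) ≤ V (A + B) ^ (1 / (n : ℝ)) := by
  have hn' : (0 : ℝ) < 1 / n := by positivity
  have hAB := hA.add hB
  have htrans : ∀ (x : EuclideanSpace ℝ (Fin n)) (S : Set (EuclideanSpace ℝ (Fin n))),
      V (x +ᵥ S) = V S := fun x S => by
    rw [V, measure_vadd, V]
  rcases (V_nonneg A).eq_or_lt with h0 | hA0
  · obtain ⟨x, hx⟩ := hA'
    rw [← h0, Real.zero_rpow hn'.ne', zero_add]
    refine Real.rpow_le_rpow (V_nonneg B) ?_ hn'.le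
    rw [← htrans x B]
    refine V_mono hAB ?_
    rintro _ ⟨y, hy, rfl⟩
    exact ⟨x, hx, y, hy, rfl⟩
  rcases (V_nonneg B).eq_or_lt with h0 | hB0
  · obtain ⟨x, hx⟩ := hB'
    rw [← h0, Real.zero_rpow hn'.ne', add_zero]
    refine Real.rpow_le_rpow (V_nonneg A) ?_ hn'.le
    rw [← htrans x A]
    refine V_mono hAB ?_
    rintro _ ⟨y, hy, rfl⟩
    exact ⟨y, hy, x, hx, add_comm _ _⟩
  set v := V A ^ (1 / (n : ℝ)) with hv
  set w := V B ^ (1 / (n : ℝ)) with hw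
  have hv0 : 0 < v := Real.rpow_pos_of_pos hA0 _
  have hw0 : 0 < w := Real.rpow_pos_of_pos hB0 _
  have hvn : V A = v ^ n := by
    rw [hv, one_div, Real.rpow_inv_natCast_pow (V_nonneg A) hn]
  have hwn : V B = w ^ n := by
    rw [hw, one_div, Real.rpow_inv_natCast_pow (V_nonneg B) hn]
  have hs : 0 < v + w := by positivity
  -- With weights proportional to the radii, both rescaled sets have volume `(v + w) ^ n`.
  have key := V_rpow_mul_V_rpow_le (hA.smul ((v + w) / v)) (hB.smul ((v + w) / w))
    (a := v / (v + w)) (b := w / (v + w)) (by positivity) (by positivity) (by field_simp)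
  rw [V_smul (by positivity), V_smul (by positivity), hvn, hwn, ← mul_pow, ← mul_pow,
    div_mul_cancel₀ _ hv0.ne', div_mul_cancel₀ _ hw0.ne', ← Real.rpow_add (by positivity),
    smul_smul, smul_smul, div_mul_div_cancel₀ hs.ne', div_mul_div_cancel₀ hs.ne',
    div_self hv0.ne', div_self hw0.ne', one_smul, one_smul, ← add_div, div_self hs.ne',
    Real.rpow_one] at key
  calc v + w = ((v + w) ^ n) ^ (1 / (n : ℝ)) := by
        rw [one_div, Real.pow_rpow_inv_natCast hs.le hn]
    _ ≤ _ := Real.rpow_le_rpow (by positivity) key hn'.le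

/-! ### Equality in the Brunn–Minkowski inequality -/

theorem V_pos_of_volume_pos {A : Set (EuclideanSpace ℝ (Fin n))} (hA : IsCompact A)
    (h : 0 < volume A) : 0 < V A :=
  ENNReal.toReal_pos h.ne' hA.measure_lt_top.ne

theorem nonempty_of_V_pos {A : Set (EuclideanSpace ℝ (Fin n))} (h : 0 < V A) : A.Nonempty := by
  by_contra hA
  rw [not_nonempty_iff_eq_empty] at hA
  simp [hA, V] at h

theorem V_eq_radius_pow (hn : n ≠ 0) (A : Set (EuclideanSpace ℝ (Fin n))) :
    V A = (V A ^ (1 / (n : ℝ))) ^ n := by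
  rw [one_div, Real.rpow_inv_natCast_pow (V_nonneg A) hn]

theorem volume_hyperplane {f : EuclideanSpace ℝ (Fin n) →L[ℝ] ℝ} (hf : f ≠ 0) (s : ℝ) :
    volume {x | f x = s} = 0 := by
  rcases ({x | f x = s} : Set (EuclideanSpace ℝ (Fin n))).eq_empty_or_nonempty with h | ⟨x, hx⟩
  · simp [h]
  · have hker : volume (f.ker : Set (EuclideanSpace ℝ (Fin n))) = 0 := by
      refine Measure.addHaar_submodule _ _ fun h => hf ?_
      ext y
      have : y ∈ f.ker := h ▸ Submodule.mem_top
      simpa using this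
    refine measure_mono_null (t := x +ᵥ (f.ker : Set (EuclideanSpace ℝ (Fin n)))) ?_
      (by rw [measure_vadd, hker])
    intro y hy
    refine ⟨y - x, ?_, by simp⟩
    simp only [mem_ofPred_eq] at hx hy
    simp [hx, hy]

theorem V_inter_le_add_V_inter_ge {f : EuclideanSpace ℝ (Fin n) →L[ℝ] ℝ} (hf : f ≠ 0)
    {A : Set (EuclideanSpace ℝ (Fin n))} (hA : IsCompact A) (s : ℝ) :
    V (A ∩ {x | f x ≤ s}) + V (A ∩ {x | s ≤ f x}) = V A := by
  have h1 : MeasurableSet (A ∩ {x | f x ≤ s}) :=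
    hA.measurableSet.inter (isClosed_le f.continuous continuous_const).measurableSet
  have hd : AEDisjoint volume (A ∩ {x | f x ≤ s}) (A ∩ {x | s ≤ f x}) :=
    measure_mono_null (fun x hx => le_antisymm hx.1.2 hx.2.2) (volume_hyperplane hf s)
  have hu : (A ∩ {x | f x ≤ s}) ∪ (A ∩ {x | s ≤ f x}) = A := by
    rw [← inter_union_distrib_left, inter_eq_left]
    exact fun x _ => le_total (f x) s
  have := measure_union₀' h1.nullMeasurableSet hd
  rw [hu] at this
  unfold V
  rw [this, ENNReal.toReal_add]
  · exact ((measure_mono inter_subset_left).trans_lt hA.measure_lt_top).ne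
  · exact ((measure_mono inter_subset_left).trans_lt hA.measure_lt_top).ne

theorem continuous_V_inter_le {f : EuclideanSpace ℝ (Fin n) →L[ℝ] ℝ} (hf : f ≠ 0)
    {B : Set (EuclideanSpace ℝ (Fin n))} (hB : IsCompact B) :
    Continuous fun t => V (B ∩ {x | f x ≤ t}) := by
  have hmeas : ∀ t : ℝ, MeasurableSet {x | f x ≤ t} := fun t =>
    (isClosed_le f.continuous continuous_const).measurableSet
  have heq : (fun t => V (B ∩ {x | f x ≤ t})) =
      fun t => ∫ x in B, ({x | f x ≤ t} : Set _).indicator (fun _ => (1 : ℝ)) x := by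
    funext t
    rw [integral_indicator_const _ (hmeas t), smul_eq_mul, mul_one, measureReal_restrict_apply
      (hmeas t), inter_comm]
    rfl
  rw [heq, continuous_iff_continuousAt]
  intro t
  have : IsFiniteMeasure (volume.restrict B) := ⟨by simpa using hB.measure_lt_top⟩
  refine continuousAt_of_dominated (bound := fun _ => 1) (Filter.Eventually.of_forall fun s =>
    (measurable_const.indicator (hmeas s)).aestronglyMeasurable)
    (Filter.Eventually.of_forall fun s => Filter.Eventually.of_forall fun x => ?_)
    (integrable_const _) ?_
  · by_cases h : f x ≤ s <;> simp [indicator, h]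
  · have : ∀ᵐ x ∂(volume.restrict B), f x ≠ t :=
      ae_restrict_of_ae (by simpa [ae_iff] using volume_hyperplane hf t)
    filter_upwards [this] with x hx
    refine ContinuousAt.congr (f := fun _ => if f x ≤ t then (1 : ℝ) else 0) continuousAt_const ?_
    rcases lt_or_gt_of_ne hx with h | h
    · filter_upwards [lt_mem_nhds h] with s hs
      simp [indicator, h.le, hs.le]
    · filter_upwards [gt_mem_nhds h] with s hs
      simp [indicator, not_le.2 h, not_le.2 hs]

theorem V_inter_le_mono (f : EuclideanSpace ℝ (Fin n) →L[ℝ] ℝ)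
    {B : Set (EuclideanSpace ℝ (Fin n))} (hB : IsCompact B) :
    Monotone fun t => V (B ∩ {x | f x ≤ t}) := fun _ _ hst =>
  V_mono (hB.inter_right (isClosed_le f.continuous continuous_const))
    fun _ hx => ⟨hx.1, le_trans hx.2 hst⟩

/-- Among the hyperplanes `f = t` cutting a given volume `β` off `B`, there is a last one. -/
theorem exists_last_cut {f : EuclideanSpace ℝ (Fin n) →L[ℝ] ℝ} (hf : f ≠ 0)
    {B : Set (EuclideanSpace ℝ (Fin n))} (hB : IsCompact B) {β : ℝ} (h0 : 0 < β) (h1 : β < V B) :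
    ∃ t, V (B ∩ {x | f x ≤ t}) = β ∧ ∀ t', t < t' → β < V (B ∩ {x | f x ≤ t'}) := by
  obtain ⟨C, hC⟩ := hB.exists_bound_of_continuousOn f.continuous.continuousOn
  have hlo : V (B ∩ {x | f x ≤ -C - 1}) = 0 := by
    have : B ∩ {x | f x ≤ -C - 1} = ∅ := by
      refine eq_empty_of_forall_notMem fun x hx => ?_
      have h2 := (abs_le.1 (hC x hx.1)).1
      have h3 : f x ≤ -C - 1 := hx.2
      linarith
    simp [this, V]
  have hhi : V (B ∩ {x | f x ≤ C}) = V B := by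
    rw [inter_eq_left.2]
    exact fun x hx => (abs_le.1 (hC x hx)).2
  have hmono := V_inter_le_mono f hB
  have hcont := continuous_V_inter_le hf hB
  set T := {t | V (B ∩ {x | f x ≤ t}) = β} with hT
  have hTsub : T ⊆ Icc (-C - 1) C := by
    intro t ht
    simp only [hT, mem_ofPred_eq] at ht
    constructor
    · by_contra hlt
      have := hmono (not_le.1 hlt).le
      simp only [ht, hlo] at this
      linarith
    · by_contra hlt
      have := hmono (not_le.1 hlt).le
      simp only [ht, hhi] at this
      linarith
  have hTc : IsCompact T :=
    isCompact_Icc.of_isClosed_subset (isClosed_eq hcont continuous_const) hTsub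
  have hTne : T.Nonempty := by
    have hle : -C - 1 ≤ C := by
      by_contra hlt
      have := hmono (not_le.1 hlt).le
      simp only [hlo, hhi] at this
      linarith
    obtain ⟨t, -, ht⟩ := intermediate_value_Icc hle hcont.continuousOn
      (show β ∈ Icc _ _ from ⟨by simp only [hlo]; exact h0.le, by simp only [hhi]; exact h1.le⟩)
    exact ⟨t, ht⟩
  obtain ⟨t, ht, hmax⟩ := hTc.exists_isMaxOn hTne continuousOn_id
  refine ⟨t, ht, fun t' htt' => lt_of_le_of_ne ?_ fun heq => ?_⟩
  · have := hmono htt'.le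
    simp only at this
    rw [← (show V (B ∩ {x | f x ≤ t}) = β from ht)]
    exact this
  · exact absurd (hmax (show t' ∈ T from heq.symm)) (not_le.2 htt')

/-- `A` and `B` are compact sets of positive volume satisfying the Brunn–Minkowski inequality with
equality. Only the nontrivial direction of the equality is recorded. -/
structure IsBrunnMinkowskiEq (A B : Set (EuclideanSpace ℝ (Fin n))) : Prop where
  compact_left : IsCompact A
  compact_right : IsCompact B
  pos_left : 0 < V A
  pos_right : 0 < V B
  le : V (A + B) ^ (1 / (n : ℝ)) ≤ V A ^ (1 / (n : ℝ)) + V B ^ (1 / (n : ℝ))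

theorem IsBrunnMinkowskiEq.symm {A B : Set (EuclideanSpace ℝ (Fin n))}
    (h : IsBrunnMinkowskiEq A B) : IsBrunnMinkowskiEq B A :=
  ⟨h.compact_right, h.compact_left, h.pos_right, h.pos_left, by
    rw [add_comm B A, add_comm (V B ^ _)]; exact h.le⟩

theorem IsBrunnMinkowskiEq.V_add_le (hn : n ≠ 0) {A B : Set (EuclideanSpace ℝ (Fin n))}
    (h : IsBrunnMinkowskiEq A B) :
    V (A + B) ≤ (V A ^ (1 / (n : ℝ)) + V B ^ (1 / (n : ℝ))) ^ n := by
  rw [V_eq_radius_pow hn (A + B)]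
  exact pow_le_pow_left₀ (Real.rpow_nonneg (V_nonneg _) _) h.le n

/-- Cutting both sets in the same ratio `α` by parallel hyperplanes splits the Minkowski sum into
two nonoverlapping pieces to which the Brunn–Minkowski inequality applies with the factors `α` and
`1 - α`. Equality for the whole therefore forces equality for the lower parts, and leaves no
volume in `A + B` outside the two pieces. -/
theorem IsBrunnMinkowskiEq.split (hn : n ≠ 0) {A B : Set (EuclideanSpace ℝ (Fin n))}
    (h : IsBrunnMinkowskiEq A B) {f : EuclideanSpace ℝ (Fin n) →L[ℝ] ℝ} (hf : f ≠ 0) {s t α : ℝ}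
    (h0 : 0 < α) (h1 : α < 1) (hA : V (A ∩ {x | f x ≤ s}) = α * V A)
    (hB : V (B ∩ {x | f x ≤ t}) = α * V B) :
    IsBrunnMinkowskiEq (A ∩ {x | f x ≤ s}) (B ∩ {x | f x ≤ t}) ∧
    V (A + B) ≤ V ((A ∩ {x | f x ≤ s} + B ∩ {x | f x ≤ t}) ∪
      (A ∩ {x | s ≤ f x} + B ∩ {x | t ≤ f x})) := by
  have hle : ∀ c, IsClosed {x | f x ≤ c} := fun c => isClosed_le f.continuous continuous_const
  have hge : ∀ c, IsClosed {x | c ≤ f x} := fun c => isClosed_le continuous_const f.continuous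
  have hA1 := h.compact_left.inter_right (hle s)
  have hA2 := h.compact_left.inter_right (hge s)
  have hB1 := h.compact_right.inter_right (hle t)
  have hB2 := h.compact_right.inter_right (hge t)
  have hVA2 : V (A ∩ {x | s ≤ f x}) = (1 - α) * V A := by
    linarith [V_inter_le_add_V_inter_ge hf h.compact_left s]
  have hVB2 : V (B ∩ {x | t ≤ f x}) = (1 - α) * V B := by
    linarith [V_inter_le_add_V_inter_ge hf h.compact_right t]
  have hpA := h.pos_left
  have hpB := h.pos_right
  have hα' : 0 < 1 - α := by linarith
  set v := V A ^ (1 / (n : ℝ)) with hv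
  set w := V B ^ (1 / (n : ℝ)) with hw
  have hv0 : 0 ≤ v := Real.rpow_nonneg hpA.le _
  have hw0 : 0 ≤ w := Real.rpow_nonneg hpB.le _
  have hpiece : ∀ {γ : ℝ} {A' B' : Set (EuclideanSpace ℝ (Fin n))}, 0 < γ → IsCompact A' →
      IsCompact B' → V A' = γ * V A → V B' = γ * V B →
      γ * (v + w) ^ n ≤ V (A' + B') := by
    intro γ A' B' hγ hA' hB' hVA' hVB'
    have hbm := brunnMinkowski hn hA' hB' (nonempty_of_V_pos (by rw [hVA']; positivity))
      (nonempty_of_V_pos (by rw [hVB']; positivity))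
    rw [hVA', hVB', Real.mul_rpow hγ.le hpA.le, Real.mul_rpow hγ.le hpB.le, ← mul_add] at hbm
    calc γ * (v + w) ^ n = (γ ^ (1 / (n : ℝ)) * (v + w)) ^ n := by
          rw [mul_pow, one_div, Real.rpow_inv_natCast_pow hγ.le hn]
      _ ≤ (V (A' + B') ^ (1 / (n : ℝ))) ^ n := pow_le_pow_left₀ (by positivity) hbm n
      _ = V (A' + B') := (V_eq_radius_pow hn _).symm
  have hS1 := hpiece h0 hA1 hB1 hA hB
  have hS2 := hpiece hα' hA2 hB2 hVA2 hVB2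
  set S1 := A ∩ {x | f x ≤ s} + B ∩ {x | f x ≤ t} with hS1def
  set S2 := A ∩ {x | s ≤ f x} + B ∩ {x | t ≤ f x} with hS2def
  have hS1c : IsCompact S1 := hA1.add hB1
  have hS2c : IsCompact S2 := hA2.add hB2
  have hunion : V (S1 ∪ S2) = V S1 + V S2 := by
    have hd : AEDisjoint volume S1 S2 := by
      refine measure_mono_null ?_ (volume_hyperplane hf (s + t))
      rintro _ ⟨⟨x, hx, y, hy, rfl⟩, ⟨x', hx', y', hy', hxy⟩⟩
      have e1 : f x ≤ s := hx.2
      have e2 : f y ≤ t := hy.2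
      have e3 : s ≤ f x' := hx'.2
      have e4 : t ≤ f y' := hy'.2
      have e5 : f x' + f y' = f x + f y := by
        rw [← map_add, ← map_add]; exact congrArg f hxy
      show f (x + y) = s + t
      rw [map_add]
      linarith
    unfold V
    rw [measure_union₀' hS1c.measurableSet.nullMeasurableSet hd,
      ENNReal.toReal_add hS1c.measure_lt_top.ne hS2c.measure_lt_top.ne]
  have hsub : V (S1 ∪ S2) ≤ V (A + B) :=
    V_mono (h.compact_left.add h.compact_right) (union_subset
      (add_subset_add inter_subset_left inter_subset_left)
      (add_subset_add inter_subset_left inter_subset_left))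
  have htot : V (A + B) ≤ (v + w) ^ n := h.V_add_le hn
  refine ⟨⟨hA1, hB1, by rw [hA]; positivity, by rw [hB]; positivity, ?_⟩, by linarith⟩
  rw [hA, hB, Real.mul_rpow h0.le hpA.le, Real.mul_rpow h0.le hpB.le, ← mul_add]
  have hS1eq : V S1 ≤ α * (v + w) ^ n := by linarith
  calc V S1 ^ (1 / (n : ℝ)) ≤ (α * (v + w) ^ n) ^ (1 / (n : ℝ)) :=
        Real.rpow_le_rpow (V_nonneg _) hS1eq (by positivity)
    _ = α ^ (1 / (n : ℝ)) * (v + w) := by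
        rw [Real.mul_rpow h0.le (by positivity), one_div,
          Real.pow_rpow_inv_natCast (by positivity) hn]

theorem IsBrunnMinkowskiEq.of_subset {A A' B : Set (EuclideanSpace ℝ (Fin n))}
    (h : IsBrunnMinkowskiEq A B) (hA' : IsCompact A') (hsub : A' ⊆ A) (hV : V A' = V A) :
    IsBrunnMinkowskiEq A' B :=
  ⟨hA', h.compact_right, hV ▸ h.pos_left, h.pos_right, by
    rw [hV]
    exact (Real.rpow_le_rpow (V_nonneg _) (V_mono (h.compact_left.add h.compact_right)
      (add_subset_add_right hsub)) (by positivity)).trans h.le⟩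

/-- Equality in the Brunn–Minkowski inequality is inherited by the part of `A` in a half-space. -/
theorem IsBrunnMinkowskiEq.exists_halfSpace (hn : n ≠ 0) {A B : Set (EuclideanSpace ℝ (Fin n))}
    (h : IsBrunnMinkowskiEq A B) (f : EuclideanSpace ℝ (Fin n) →L[ℝ] ℝ) (s : ℝ)
    (hpos : 0 < V (A ∩ {x | f x ≤ s})) :
    ∃ B', IsBrunnMinkowskiEq (A ∩ {x | f x ≤ s}) B' := by
  have hc := h.compact_left.inter_right (isClosed_le f.continuous (continuous_const (y := s)))
  have hle : V (A ∩ {x | f x ≤ s}) ≤ V A := V_mono h.compact_left inter_subset_left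
  rcases hle.eq_or_lt with heq | hlt
  · exact ⟨B, h.of_subset hc inter_subset_left heq⟩
  have hf : f ≠ 0 := by
    rintro rfl
    by_cases hs : 0 ≤ s
    · simp [hs] at hlt
    · simp [hs, V] at hpos
  have hpA := h.pos_left
  have hpB := h.pos_right
  have h1 : V (A ∩ {x | f x ≤ s}) / V A < 1 := (div_lt_one hpA).2 hlt
  obtain ⟨t, ht, -⟩ := exists_last_cut hf h.compact_right
    (β := V (A ∩ {x | f x ≤ s}) / V A * V B) (by positivity) (by nlinarith)
  exact ⟨_, (h.split hn hf (by positivity) h1 (by field_simp) ht).1⟩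

/-- Equality in the Brunn–Minkowski inequality is inherited by the part of `A` in a polyhedron. -/
theorem IsBrunnMinkowskiEq.exists_polyhedron (hn : n ≠ 0) {ι : Type*} (I : Finset ι)
    {A B : Set (EuclideanSpace ℝ (Fin n))} (h : IsBrunnMinkowskiEq A B)
    (f : ι → EuclideanSpace ℝ (Fin n) →L[ℝ] ℝ) (s : ι → ℝ)
    (hpos : 0 < V (A ∩ {x | ∀ i ∈ I, f i x ≤ s i})) :
    ∃ B', IsBrunnMinkowskiEq (A ∩ {x | ∀ i ∈ I, f i x ≤ s i}) B' := by
  classical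
  induction I using Finset.induction_on with
  | empty => exact ⟨B, by simpa using h⟩
  | insert i I hi ih =>
    have heq : A ∩ {x | ∀ j ∈ insert i I, f j x ≤ s j} =
        (A ∩ {x | ∀ j ∈ I, f j x ≤ s j}) ∩ {x | f i x ≤ s i} := by
      ext x
      simp only [Finset.forall_mem_insert, mem_inter_iff, mem_ofPred_eq]
      tauto
    have hcl : IsClosed {x | ∀ j ∈ I, f j x ≤ s j} := by
      simp only [ofPred_forall]
      exact isClosed_biInter fun j _ => isClosed_le (f j).continuous continuous_const
    rw [heq] at hpos ⊢
    obtain ⟨B', hB'⟩ := ih (hpos.trans_le (V_mono (h.compact_left.inter_right hcl)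
      inter_subset_left))
    exact hB'.exists_halfSpace hn (f i) (s i) hpos

/-- In the equality case `A` cannot have parts of positive volume on both sides of an empty slab:
sums of a topmost point of the lower part of `A` with points of `B` just above the matching cut
would fill additional volume inside the slab. -/
theorem IsBrunnMinkowskiEq.false_of_gap (hn : n ≠ 0) {A B : Set (EuclideanSpace ℝ (Fin n))}
    (h : IsBrunnMinkowskiEq A B) {f : EuclideanSpace ℝ (Fin n) →L[ℝ] ℝ} {s δ : ℝ} (hδ : 0 < δ)
    (hgap : ∀ x ∈ A, δ ≤ |f x - s|) (hlo : 0 < V (A ∩ {x | f x ≤ s}))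
    (hhi : 0 < V (A ∩ {x | s ≤ f x})) : False := by
  have hf : f ≠ 0 := by
    rintro rfl
    obtain ⟨x, hx, hx2⟩ := nonempty_of_V_pos hlo
    obtain ⟨y, hy, hy2⟩ := nonempty_of_V_pos hhi
    have := hgap x hx
    have e1 : (0 : ℝ) ≤ s := by simpa using hx2
    have e2 : s ≤ 0 := by simpa using hy2
    rw [le_antisymm e2 e1] at this
    simp at this
    linarith
  have hpA := h.pos_left
  have hpB := h.pos_right
  have hsum := V_inter_le_add_V_inter_ge hf h.compact_left s
  have h1 : V (A ∩ {x | f x ≤ s}) / V A < 1 := (div_lt_one hpA).2 (by linarith)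
  obtain ⟨t, ht, hlast⟩ := exists_last_cut hf h.compact_right
    (β := V (A ∩ {x | f x ≤ s}) / V A * V B) (by positivity) (by nlinarith)
  have hle := (h.split hn hf (by positivity) h1 (by field_simp) ht).2
  have hcl : ∀ c, IsClosed {x | f x ≤ c} := fun c => isClosed_le f.continuous continuous_const
  have hge : ∀ c, IsClosed {x | c ≤ f x} := fun c => isClosed_le continuous_const f.continuous
  have hA1 := h.compact_left.inter_right (hcl s)
  obtain ⟨a, ha, hmax⟩ := hA1.exists_isMaxOn (nonempty_of_V_pos hlo) f.continuous.continuousOn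
  have hlow : ∀ x ∈ A, f x ≤ s → f x ≤ s - δ := fun x hx hxs => by
    have := hgap x hx
    rw [abs_of_nonpos (by linarith)] at this
    linarith
  have hhigh : ∀ x ∈ A, s ≤ f x → s + δ ≤ f x := fun x hx hxs => by
    have := hgap x hx
    rw [abs_of_nonneg (by linarith)] at this
    linarith
  have has := hlow a ha.1 ha.2
  set D := (B ∩ {x | f x ≤ t + δ}) \ (B ∩ {x | f x ≤ t}) with hD
  set U := (A ∩ {x | f x ≤ s} + B ∩ {x | f x ≤ t}) ∪
      (A ∩ {x | s ≤ f x} + B ∩ {x | t ≤ f x}) with hU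
  have hUc : IsCompact U := (hA1.add (h.compact_right.inter_right (hcl t))).union
    ((h.compact_left.inter_right (hge s)).add (h.compact_right.inter_right (hge t)))
  have hDpos : 0 < volume D := by
    have hlt := hlast (t + δ) (by linarith)
    rw [← ht] at hlt
    have hlt' : volume (B ∩ {x | f x ≤ t}) < volume (B ∩ {x | f x ≤ t + δ}) :=
      (ENNReal.toReal_lt_toReal
        (h.compact_right.inter_right (hcl _)).measure_lt_top.ne
        (h.compact_right.inter_right (hcl _)).measure_lt_top.ne).1 hlt
    exact (tsub_pos_of_lt hlt').trans_le le_measure_sdiff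
  have hdisj : Disjoint U (a +ᵥ D) := by
    rw [disjoint_left]
    rintro _ hz ⟨y, hy, rfl⟩
    have e1 : f y ≤ t + δ := hy.1.2
    have e2 : t < f y := by
      by_contra hlt
      exact hy.2 ⟨hy.1.1, not_lt.1 hlt⟩
    rcases hz with ⟨x', hx', y', hy', hxy⟩ | ⟨x', hx', y', hy', hxy⟩
    · have e3 : f x' + f y' = f a + f y := by
        rw [← map_add, ← map_add]; exact congrArg f hxy
      have e4 : f x' ≤ f a := hmax hx'
      have e5 : f y' ≤ t := hy'.2
      linarith
    · have e3 : f x' + f y' = f a + f y := by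
        rw [← map_add, ← map_add]; exact congrArg f hxy
      have e4 := hhigh x' hx'.1 hx'.2
      have e5 : t ≤ f y' := hy'.2
      linarith
  have hsub : U ∪ (a +ᵥ D) ⊆ A + B := by
    refine union_subset (union_subset
      (add_subset_add inter_subset_left inter_subset_left)
      (add_subset_add inter_subset_left inter_subset_left)) ?_
    rintro _ ⟨y, hy, rfl⟩
    exact ⟨a, ha.1, y, hy.1.1, rfl⟩
  have hABc := h.compact_left.add h.compact_right
  have h2 : volume U + volume D ≤ volume (A + B) := by
    rw [← measure_vadd volume a D, ← measure_union' hdisj hUc.measurableSet]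
    exact measure_mono hsub
  have h3 : volume (A + B) ≤ volume U :=
    (ENNReal.toReal_le_toReal hABc.measure_lt_top.ne hUc.measure_lt_top.ne).1 hle
  exact absurd (h2.trans h3) (not_le.2 (ENNReal.lt_add_right hUc.measure_lt_top.ne hDpos.ne'))

theorem norm_le_sum_abs (w : EuclideanSpace ℝ (Fin n)) : ‖w‖ ≤ ∑ i, |w i| := by
  rw [EuclideanSpace.norm_eq]
  refine Real.sqrt_le_iff.2 ⟨Finset.sum_nonneg fun i _ => abs_nonneg _, ?_⟩
  simp only [Real.norm_eq_abs]
  exact Finset.sum_sq_le_sq_sum_of_nonneg fun i _ => abs_nonneg _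

/-- In the equality case, the segment between two points of the measure-theoretic support of `A`
stays in `A`: a thin tube around the segment would otherwise contain a gap of `A`. -/
theorem IsBrunnMinkowskiEq.segment_subset (hn : n ≠ 0) {A B : Set (EuclideanSpace ℝ (Fin n))}
    (h : IsBrunnMinkowskiEq A B) {x y : EuclideanSpace ℝ (Fin n)}
    (hx : x ∈ (volume.restrict A).support) (hy : y ∈ (volume.restrict A).support) :
    segment ℝ x y ⊆ A := by
  have hAcl := h.compact_left.isClosed
  have hsuppA : (volume.restrict A).support ⊆ A := fun z hz => by
    have := (Measure.support_restrict_subset hz).1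
    rwa [hAcl.closure_eq] at this
  rcases eq_or_ne x y with rfl | hxy
  · rw [segment_same]
    simpa using hsuppA hx
  rw [segment_eq_image']
  rintro _ ⟨θ, ⟨hθ0, hθ1⟩, rfl⟩
  by_contra hm
  simp only at hm
  set m := x + θ • (y - x) with hmdef
  obtain ⟨ε, hε, hball⟩ := Metric.isOpen_iff.1 hAcl.isOpen_compl m hm
  have hθ0' : 0 < θ := lt_of_le_of_ne hθ0 (by
    rintro rfl
    exact hm (by simpa [hmdef] using hsuppA hx))
  have hθ1' : θ < 1 := lt_of_le_of_ne hθ1 (by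
    rintro rfl
    exact hm (by simpa [hmdef] using hsuppA hy))
  obtain ⟨j, hj⟩ : ∃ j, x j ≠ y j := by
    by_contra hall
    push Not at hall
    exact hxy (PiLp.ext hall)
  have hj' : y j - x j ≠ 0 := sub_ne_zero.2 hj.symm
  -- `e` is a coordinate along the line through `x` and `y`; the functionals `P i` are constant
  -- on that line.
  let e : EuclideanSpace ℝ (Fin n) →L[ℝ] ℝ := (y j - x j)⁻¹ • EuclideanSpace.proj j
  have he : ∀ z, e z = (y j - x j)⁻¹ * z j := fun z => rfl
  let P : Fin n → EuclideanSpace ℝ (Fin n) →L[ℝ] ℝ :=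
    fun i => EuclideanSpace.proj i - (y i - x i) • e
  have hP : ∀ i z, P i z = z i - (y i - x i) * e z := fun i z => rfl
  have hmi : ∀ i, m i = x i + θ * (y i - x i) := fun i => by simp [hmdef]
  have hem : e m = e x + θ := by
    rw [he, he, hmi]; field_simp
  have hey : e y = e x + 1 := by
    rw [he, he]; field_simp; ring
  have hPx : ∀ i, P i x = P i m := fun i => by rw [hP, hP, hem, hmi]; ring
  have hPy : ∀ i, P i y = P i m := fun i => by rw [hP, hP, hem, hey, hmi]; ring
  set C : ℝ := n + ∑ i, |y i - x i| + 1 with hC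
  have hC0 : 0 < C := by
    have : 0 ≤ ∑ i, |y i - x i| := Finset.sum_nonneg fun i _ => abs_nonneg _
    positivity
  set δ := ε / C with hδdef
  have hδ : 0 < δ := div_pos hε hC0
  have hnear : ∀ z, (∀ i, |P i z - P i m| ≤ δ) → |e z - e m| < δ → z ∉ A := by
    intro z hz1 hz2
    refine hball ?_
    rw [Metric.mem_ball, dist_eq_norm]
    refine (norm_le_sum_abs _).trans_lt ?_
    calc ∑ i, |(z - m) i| ≤ ∑ i, (δ + |y i - x i| * δ) := by
          refine Finset.sum_le_sum fun i _ => ?_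
          have : (z - m) i = (P i z - P i m) + (y i - x i) * (e z - e m) := by
            rw [hP, hP, PiLp.sub_apply]; ring
          rw [this]
          refine (abs_add_le _ _).trans (add_le_add (hz1 i) ?_)
          rw [abs_mul]
          exact mul_le_mul_of_nonneg_left hz2.le (abs_nonneg _)
      _ = δ * (C - 1) := by
          rw [Finset.sum_add_distrib, ← Finset.sum_mul, hC]
          simp
          ring
      _ < ε := by
          have : δ * C = ε := div_mul_cancel₀ _ hC0.ne'
          linarith
  let F : Fin n × Bool → EuclideanSpace ℝ (Fin n) →L[ℝ] ℝ :=
    fun q => if q.2 then P q.1 else -P q.1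
  let s : Fin n × Bool → ℝ := fun q => (if q.2 then P q.1 m else -P q.1 m) + δ
  set T : Set (EuclideanSpace ℝ (Fin n)) := {z | ∀ q ∈ (Finset.univ : Finset (Fin n × Bool)),
    F q z ≤ s q} with hT
  have hTmem : ∀ z, z ∈ T ↔ ∀ i, |P i z - P i m| ≤ δ := by
    intro z
    simp only [hT, mem_ofPred_eq, Finset.mem_univ, forall_const, Prod.forall, Bool.forall_bool]
    refine forall_congr' fun i => ?_
    rw [abs_le]
    simp only [F, s, Bool.false_eq_true, if_false, if_true, neg_apply]
    constructor
    · rintro ⟨h1, h2⟩; constructor <;> linarith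
    · rintro ⟨h1, h2⟩; constructor <;> linarith
  have hTcl : IsClosed T := by
    simp only [hT, ofPred_forall]
    exact isClosed_biInter fun q _ => isClosed_le (F q).continuous continuous_const
  have hAT := h.compact_left.inter_right hTcl
  have hVpos : ∀ (S : Set (EuclideanSpace ℝ (Fin n))) (z : EuclideanSpace ℝ (Fin n)),
      IsClosed S → S ∈ 𝓝 z → (∀ i, P i z = P i m) → z ∈ (volume.restrict A).support →
      0 < V (A ∩ T ∩ S) := by
    intro S z hScl hS hz hsupp
    have hTn : T ∈ 𝓝 z := by
      have : ∀ᶠ w in 𝓝 z, ∀ i, |P i w - P i m| < δ := by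
        refine Filter.eventually_all.2 fun i => ?_
        have hc : ContinuousAt (fun w => |P i w - P i m|) z := by fun_prop
        exact hc.eventually_lt_const (by simpa [hz i] using hδ)
      filter_upwards [this] with w hw
      exact (hTmem w).2 fun i => (hw i).le
    have hpos := (Measure.mem_support_iff_forall z).1 hsupp _ (Filter.inter_mem hTn hS)
    rw [Measure.restrict_apply (hTcl.inter hScl).measurableSet, inter_comm,
      ← inter_assoc] at hpos
    exact V_pos_of_volume_pos (hAT.inter_right hScl) hpos
  have hlo : 0 < V (A ∩ T ∩ {z | e z ≤ e m}) :=
    hVpos _ x (isClosed_le e.continuous continuous_const)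
      (e.continuous.continuousAt.eventually_le_const (by linarith)) hPx hx
  have hhi : 0 < V (A ∩ T ∩ {z | e m ≤ e z}) :=
    hVpos _ y (isClosed_le continuous_const e.continuous)
      (e.continuous.continuousAt.eventually_const_le (by linarith)) hPy hy
  obtain ⟨B', hB'⟩ := h.exists_polyhedron hn Finset.univ F s
    (hlo.trans_le (V_mono hAT inter_subset_left))
  refine hB'.false_of_gap hn hδ (fun z hz => ?_) hlo hhi
  by_contra hlt
  exact hnear z ((hTmem z).1 hz.2) (not_le.1 hlt) hz.1

/-- A compact set `M` contains every convex set of positive volume lying in a compact set that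
exceeds `M` by a null set only. -/
theorem subset_of_V_le_of_convex {S M D : Set (EuclideanSpace ℝ (Fin n))} (hS : IsCompact S)
    (hM : IsCompact M) (hMS : M ⊆ S) (hV : V S ≤ V M) (hD : Convex ℝ D) (hDS : D ⊆ S)
    (hDpos : 0 < volume D) : D ⊆ M := by
  intro x hx
  by_contra hxM
  obtain ⟨ε, hε, hball⟩ := Metric.isOpen_iff.1 hM.isClosed.isOpen_compl x hxM
  obtain ⟨R, hR0, hR⟩ := hS.isBounded.subset_ball_lt 0 x
  -- Shrinking `D` towards `x` keeps it inside `D` and moves it away from `M`.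
  set r := min 1 (ε / R) with hr
  have hr0 : 0 < r := lt_min one_pos (div_pos hε hR0)
  set D' := AffineMap.homothety x r '' D with hD'
  have hD'D : D' ⊆ D := by
    rintro _ ⟨y, hy, rfl⟩
    rw [AffineMap.homothety_apply, vsub_eq_sub, vadd_eq_add]
    rw [add_comm]
    exact hD.add_smul_sub_mem hx hy ⟨hr0.le, min_le_left _ _⟩
  have hdisj : Disjoint M D' := by
    rw [disjoint_left]
    rintro _ hzM ⟨y, hy, rfl⟩
    refine hball ?_ hzM
    rw [AffineMap.homothety_apply, vsub_eq_sub, vadd_eq_add, Metric.mem_ball, dist_eq_norm,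
      add_sub_cancel_right, norm_smul, Real.norm_of_nonneg hr0.le]
    have h1 : ‖y - x‖ < R := by
      have := hR (hDS hy)
      rwa [Metric.mem_ball, dist_eq_norm] at this
    calc r * ‖y - x‖ < r * R := mul_lt_mul_of_pos_left h1 hr0
      _ ≤ ε / R * R := mul_le_mul_of_nonneg_right (min_le_right _ _) hR0.le
      _ = ε := div_mul_cancel₀ _ hR0.ne'
  have hpos : volume D' ≠ 0 := by
    rw [hD', Measure.addHaar_image_homothety]
    exact mul_ne_zero (by simp [hr0.ne']) hDpos.ne'
  have h1 : volume S ≤ volume M :=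
    (ENNReal.toReal_le_toReal hS.measure_lt_top.ne hM.measure_lt_top.ne).1 hV
  have h2 : volume M + volume D' ≤ volume S := by
    rw [← measure_union' hdisj hM.measurableSet]
    exact measure_mono (union_subset hMS (hD'D.trans hDS))
  exact absurd (h2.trans h1) (not_le.2 (ENNReal.lt_add_right hM.measure_lt_top.ne hpos))

/-- In the equality case, the measure-theoretic support of `A` is convex, and it can replace `A`. -/
theorem IsBrunnMinkowskiEq.exists_convex (hn : n ≠ 0) {A B : Set (EuclideanSpace ℝ (Fin n))}
    (h : IsBrunnMinkowskiEq A B) :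
    ∃ A' ⊆ A, Convex ℝ A' ∧ V A' = V A ∧ IsBrunnMinkowskiEq A' B := by
  set A' := (volume.restrict A).support with hA'
  have hsub : A' ⊆ A := fun z hz => by
    have := (Measure.support_restrict_subset hz).1
    rwa [h.compact_left.isClosed.closure_eq] at this
  have hA'c : IsCompact A' := h.compact_left.of_isClosed_subset Measure.isClosed_support hsub
  have hnull : volume.restrict A A'ᶜ = 0 := Measure.measure_compl_support
  rw [Measure.restrict_apply Measure.isClosed_support.measurableSet.compl] at hnull
  have hvol : ∀ S : Set (EuclideanSpace ℝ (Fin n)), volume (S ∩ A') = volume (S ∩ A) := fun S => by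
    refine le_antisymm (measure_mono (inter_subset_inter_right _ hsub)) ?_
    calc volume (S ∩ A) ≤ volume ((S ∩ A') ∪ (A'ᶜ ∩ A)) := measure_mono fun z hz => by
          by_cases hzA : z ∈ A'
          · exact Or.inl ⟨hz.1, hzA⟩
          · exact Or.inr ⟨hzA, hz.2⟩
      _ ≤ volume (S ∩ A') + volume (A'ᶜ ∩ A) := measure_union_le _ _
      _ = volume (S ∩ A') := by rw [hnull, add_zero]
  have hV : V A' = V A := by
    have := hvol univ
    rw [univ_inter, univ_inter] at this
    rw [V, this, V]
  have hE := h.of_subset hA'c hsub hV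
  refine ⟨A', hsub, convex_iff_segment_subset.2 fun x hx y hy => ?_, hV, hE⟩
  have hrestr : volume.restrict A' = volume.restrict A := by
    ext S hS
    rw [Measure.restrict_apply hS, Measure.restrict_apply hS, hvol]
  exact hE.segment_subset hn (by rwa [hrestr]) (by rwa [hrestr])

/-- Compact sets of positive volume with equality in the Brunn–Minkowski inequality are convex. -/
theorem IsBrunnMinkowskiEq.convex_left (hn : n ≠ 0) {A B : Set (EuclideanSpace ℝ (Fin n))}
    (h : IsBrunnMinkowskiEq A B) : Convex ℝ A := by
  obtain ⟨A', hsub, hA'cv, hVA', hE⟩ := h.exists_convex hn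
  obtain ⟨B', hBsub, hB'cv, hVB', hE'⟩ := hE.symm.exists_convex hn
  suffices A ⊆ A' by rwa [this.antisymm hsub]
  intro z hz
  by_contra hzA'
  have hAB := h.compact_left.add h.compact_right
  have hAB' := hE'.symm.compact_left.add hE'.symm.compact_right
  have hVle : V (A + B) ≤ V (A' + B') := by
    have hbm := brunnMinkowski hn hE.compact_left hE'.compact_left
      (nonempty_of_V_pos hE.pos_left) (nonempty_of_V_pos hE'.pos_left)
    rw [hVA', hVB'] at hbm
    refine (h.V_add_le hn).trans ?_
    rw [V_eq_radius_pow hn (A' + B')]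
    exact pow_le_pow_left₀ (add_nonneg (Real.rpow_nonneg (V_nonneg _) _)
      (Real.rpow_nonneg (V_nonneg _) _)) hbm n
  have hzB : z +ᵥ B' ⊆ A' + B' := by
    refine subset_of_V_le_of_convex hAB hAB' (add_subset_add hsub hBsub) hVle (hB'cv.vadd z) ?_ ?_
    · rintro _ ⟨y, hy, rfl⟩
      exact ⟨z, hz, y, hBsub hy, rfl⟩
    · rw [measure_vadd]
      exact (ENNReal.toReal_pos_iff.1 hE'.pos_left).1
  obtain ⟨f, u, hf, hu⟩ := geometric_hahn_banach_closed_point hA'cv hE.compact_left.isClosed hzA'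
  obtain ⟨b, hb, hbmax⟩ := hE'.compact_left.exists_isMaxOn (nonempty_of_V_pos hE'.pos_left)
    f.continuous.continuousOn
  obtain ⟨a, ha, b', hb', hab⟩ := hzB ⟨b, hb, rfl⟩
  have h1 : f a + f b' = f z + f b := by
    rw [← map_add, ← map_add]; exact congrArg f hab
  have h2 : f b' ≤ f b := hbmax hb'
  have h3 := hf a ha
  linarith

/-! ### The planar set `J φ` and its polar set -/

theorem convex_quadrant : Convex ℝ quadrant := by
  intro z hz w hw a b ha hb _
  exact ⟨add_nonneg (mul_nonneg ha hz.1) (mul_nonneg hb hw.1),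
    add_nonneg (mul_nonneg ha hz.2) (mul_nonneg hb hw.2)⟩

theorem smul_mem_quadrant {r : ℝ} (hr : 0 ≤ r) {w : ℝ × ℝ} (hw : w ∈ quadrant) :
    r • w ∈ quadrant :=
  ⟨mul_nonneg hr hw.1, mul_nonneg hr hw.2⟩

namespace IsPhiTwo

variable {φ : ℝ × ℝ → ℝ}

theorem mono (hφ : IsPhiTwo φ) {z w : ℝ × ℝ} (hz : z ∈ quadrant) (hzw : z ≤ w) : φ z ≤ φ w :=
  (hφ.mono_left z.1 w.1 z.2 hz.1 hzw.1 hz.2).trans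
    (hφ.mono_right w.1 z.2 w.2 (hz.1.trans hzw.1) hz.2 hzw.2)

theorem map_smul_le (hφ : IsPhiTwo φ) {w : ℝ × ℝ} (hw : w ∈ quadrant) {r : ℝ} (h0 : 0 ≤ r)
    (h1 : r ≤ 1) : φ (r • w) ≤ r * φ w := by
  have := hφ.convex.2 hw (show (0, 0) ∈ quadrant from ⟨le_rfl, le_rfl⟩) h0 (sub_nonneg.2 h1)
    (by ring)
  rw [hφ.map_zero, show ((0 : ℝ), (0 : ℝ)) = 0 from rfl, smul_zero, add_zero] at this
  simpa using this

theorem fst_le_one (hφ : IsPhiTwo φ) {w : ℝ × ℝ} (hw : w ∈ quadrant) (h : φ w ≤ 1) :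
    w.1 ≤ 1 := by
  by_contra hlt
  rw [not_le] at hlt
  have h0 : 0 < w.1 := by linarith
  have h1 : φ (w.1, 0) ≤ 1 := (hφ.mono_right w.1 0 w.2 hw.1 le_rfl hw.2).trans h
  have h2 := hφ.map_smul_le (w := (w.1, 0)) ⟨hw.1, le_rfl⟩ (inv_nonneg.2 h0.le)
    (inv_le_one_of_one_le₀ hlt.le)
  rw [show w.1⁻¹ • (w.1, (0 : ℝ)) = (1, 0) by
    simp [Prod.smul_mk, h0.ne'], hφ.map_left] at h2
  have h3 : w.1⁻¹ < 1 := inv_lt_one_of_one_lt₀ hlt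
  nlinarith [inv_pos.2 h0]

theorem snd_le_one (hφ : IsPhiTwo φ) {w : ℝ × ℝ} (hw : w ∈ quadrant) (h : φ w ≤ 1) :
    w.2 ≤ 1 := by
  by_contra hlt
  rw [not_le] at hlt
  have h0 : 0 < w.2 := by linarith
  have h1 : φ (0, w.2) ≤ 1 := (hφ.mono_left 0 w.1 w.2 le_rfl hw.1 hw.2).trans h
  have h2 := hφ.map_smul_le (w := (0, w.2)) ⟨le_rfl, hw.2⟩ (inv_nonneg.2 h0.le)
    (inv_le_one_of_one_le₀ hlt.le)
  rw [show w.2⁻¹ • ((0 : ℝ), w.2) = (0, 1) by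
    simp [Prod.smul_mk, h0.ne'], hφ.map_right] at h2
  have h3 : w.2⁻¹ < 1 := inv_lt_one_of_one_lt₀ hlt
  nlinarith [inv_pos.2 h0]

/-- Upper semicontinuity of `φ` along rays. -/
theorem exists_one_lt_map_smul_le (hφ : IsPhiTwo φ) {w : ℝ × ℝ} (hw : w ∈ quadrant)
    (h : φ w < 1) : ∃ r : ℝ, 1 < r ∧ φ (r • w) ≤ 1 := by
  have h2 : (2 : ℝ) • w ∈ quadrant := smul_mem_quadrant (by norm_num) hw
  have hp := hφ.nonneg _ hw
  have hq := hφ.nonneg _ h2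
  set t := min 1 ((1 - φ w) / (φ ((2 : ℝ) • w) + 1)) with ht
  have ht0 : 0 < t := lt_min one_pos (div_pos (by linarith) (by linarith))
  have ht1 : t ≤ 1 := min_le_left _ _
  have ht2 : t * (φ ((2 : ℝ) • w) + 1) ≤ 1 - φ w :=
    (le_div_iff₀ (by linarith)).1 (min_le_right _ _)
  refine ⟨1 + t, by linarith, ?_⟩
  have := hφ.convex.2 hw h2 (sub_nonneg.2 ht1) ht0.le (by ring)
  rw [smul_smul, ← add_smul, smul_eq_mul, smul_eq_mul,
    show 1 - t + t * 2 = 1 + t by ring] at this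
  nlinarith

/-- Lower semicontinuity of `φ` along rays: `w` is a convex combination of `r • w` and `2 • w`. -/
theorem map_le_one_of_forall_smul (hφ : IsPhiTwo φ) {w : ℝ × ℝ} (hw : w ∈ quadrant)
    (h : ∀ r : ℝ, 0 ≤ r → r < 1 → φ (r • w) ≤ 1) : φ w ≤ 1 := by
  by_contra hlt
  rw [not_le] at hlt
  have h2 : (2 : ℝ) • w ∈ quadrant := smul_mem_quadrant (by norm_num) hw
  have hq := hφ.nonneg _ h2
  set t := min 1 ((φ w - 1) / (φ ((2 : ℝ) • w) + 1)) with ht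
  have ht0 : 0 < t := lt_min one_pos (div_pos (by linarith) (by linarith))
  have ht1 : t ≤ 1 := min_le_left _ _
  have ht2 : t * (φ ((2 : ℝ) • w) + 1) ≤ φ w - 1 :=
    (le_div_iff₀ (by linarith)).1 (min_le_right _ _)
  have hr := h (1 - t) (by linarith) (by linarith)
  have := hφ.convex.2 (smul_mem_quadrant (sub_nonneg.2 ht1) hw) h2
    (show 0 ≤ 1 / (1 + t) by positivity) (show 0 ≤ t / (1 + t) by positivity) (by field_simp)
  rw [smul_smul, smul_smul, ← add_smul, smul_eq_mul, smul_eq_mul,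
    show 1 / (1 + t) * (1 - t) + t / (1 + t) * 2 = 1 by field_simp; ring, one_smul,
    ← mul_le_mul_iff_right₀ (show 0 < 1 + t by linarith)] at this
  have e : (1 + t) * (1 / (1 + t) * φ ((1 - t) • w) + t / (1 + t) * φ ((2 : ℝ) • w)) =
      φ ((1 - t) • w) + t * φ ((2 : ℝ) • w) := by field_simp
  rw [e] at this
  nlinarith

theorem mem_J_iff (hφ : IsPhiTwo φ) {w : ℝ × ℝ} : w ∈ J φ ↔ φ (|w.1|, |w.2|) ≤ 1 := by
  refine ⟨fun h => h.2.2, fun h => ⟨?_, ?_, h⟩⟩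
  · exact hφ.fst_le_one (w := (|w.1|, |w.2|)) ⟨abs_nonneg _, abs_nonneg _⟩ h
  · exact hφ.snd_le_one (w := (|w.1|, |w.2|)) ⟨abs_nonneg _, abs_nonneg _⟩ h

theorem convex_J (hφ : IsPhiTwo φ) : Convex ℝ (J φ) := by
  intro z hz w hw a b ha hb hab
  rw [hφ.mem_J_iff] at *
  have hz' : (|z.1|, |z.2|) ∈ quadrant := ⟨abs_nonneg _, abs_nonneg _⟩
  have hw' : (|w.1|, |w.2|) ∈ quadrant := ⟨abs_nonneg _, abs_nonneg _⟩
  have hle : ∀ s t : ℝ, |a * s + b * t| ≤ a * |s| + b * |t| := fun s t => by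
    simpa [abs_mul, abs_of_nonneg ha, abs_of_nonneg hb] using abs_add_le (a * s) (b * t)
  calc φ (|(a • z + b • w).1|, |(a • z + b • w).2|)
      ≤ φ (a • (|z.1|, |z.2|) + b • (|w.1|, |w.2|)) :=
        hφ.mono ⟨abs_nonneg _, abs_nonneg _⟩ ⟨hle _ _, hle _ _⟩
    _ ≤ a • φ (|z.1|, |z.2|) + b • φ (|w.1|, |w.2|) := hφ.convex.2 hz' hw' ha hb hab
    _ ≤ a * 1 + b * 1 := add_le_add (mul_le_mul_of_nonneg_left hz ha)
        (mul_le_mul_of_nonneg_left hw hb)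
    _ = 1 := by linarith

/-- No continuity of `φ` on the boundary of the quadrant is needed: a point slightly inside a limit
of points of `J φ` is dominated by one of them. -/
theorem isClosed_J (hφ : IsPhiTwo φ) : IsClosed (J φ) := by
  refine isClosed_of_closure_subset fun w hw => ?_
  rw [hφ.mem_J_iff]
  refine hφ.map_le_one_of_forall_smul ⟨abs_nonneg _, abs_nonneg _⟩ fun r hr0 hr1 => ?_
  have hev : ∀ g : ℝ × ℝ → ℝ, Continuous g → ∀ᶠ u in 𝓝 w, r * |g w| ≤ |g u| := by
    intro g hg
    rcases eq_or_ne (g w) 0 with h | h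
    · filter_upwards with u
      simp [h]
    · have hpos : 0 < |g w| := abs_pos.2 h
      exact (hg.abs.continuousAt (x := w)).eventually_const_le (by nlinarith)
  obtain ⟨u, hu, hu1, hu2⟩ := ((mem_closure_iff_frequently.1 hw).and_eventually
    ((hev _ continuous_fst).and (hev _ continuous_snd))).exists
  exact (hφ.mono (w := (|u.1|, |u.2|)) (smul_mem_quadrant hr0 ⟨abs_nonneg _, abs_nonneg _⟩)
    ⟨hu1, hu2⟩).trans (hφ.mem_J_iff.1 hu)

end IsPhiTwo

/-- The part of the polar set of `J φ` in the closed quadrant. -/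
def polarQuadrant (φ : ℝ × ℝ → ℝ) : Set (ℝ × ℝ) := polarSet (J φ) ∩ quadrant

/-- The upper right boundary of the polar set of `J φ`: the maximal points of `polarQuadrant φ` for
the componentwise order. The coefficient pairs occurring in the Orlicz sum are exactly these. -/
def upperArc (φ : ℝ × ℝ → ℝ) : Set (ℝ × ℝ) := {z | Maximal (· ∈ polarQuadrant φ) z}

namespace IsPhiTwo

variable {φ : ℝ × ℝ → ℝ}

theorem mem_polarQuadrant_iff (hφ : IsPhiTwo φ) {z : ℝ × ℝ} : z ∈ polarQuadrant φ ↔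
    z ∈ quadrant ∧ ∀ w ∈ quadrant, φ w ≤ 1 → z.1 * w.1 + z.2 * w.2 ≤ 1 := by
  constructor
  · rintro ⟨h1, h2⟩
    refine ⟨h2, fun w hw hw1 => h1 w (hφ.mem_J_iff.2 ?_)⟩
    rwa [abs_of_nonneg hw.1, abs_of_nonneg hw.2]
  · rintro ⟨h1, h2⟩
    refine ⟨fun w hw => ?_, h1⟩
    have := h2 (|w.1|, |w.2|) ⟨abs_nonneg _, abs_nonneg _⟩ (hφ.mem_J_iff.1 hw)
    exact (add_le_add (mul_le_mul_of_nonneg_left (le_abs_self _) h1.1)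
      (mul_le_mul_of_nonneg_left (le_abs_self _) h1.2)).trans this

theorem mem_polarQuadrant_of_le (hφ : IsPhiTwo φ) {z z' : ℝ × ℝ} (hz : z ∈ polarQuadrant φ)
    (hz' : z' ∈ quadrant) (hle : z' ≤ z) : z' ∈ polarQuadrant φ := by
  rw [hφ.mem_polarQuadrant_iff] at *
  exact ⟨hz', fun w hw hw1 => (add_le_add (mul_le_mul_of_nonneg_right hle.1 hw.1)
    (mul_le_mul_of_nonneg_right hle.2 hw.2)).trans (hz.2 w hw hw1)⟩

theorem one_zero_mem_polarQuadrant (hφ : IsPhiTwo φ) : ((1 : ℝ), (0 : ℝ)) ∈ polarQuadrant φ :=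
  hφ.mem_polarQuadrant_iff.2 ⟨⟨zero_le_one, le_rfl⟩, fun w hw hw1 => by
    simpa using hφ.fst_le_one hw hw1⟩

theorem zero_one_mem_polarQuadrant (hφ : IsPhiTwo φ) : ((0 : ℝ), (1 : ℝ)) ∈ polarQuadrant φ :=
  hφ.mem_polarQuadrant_iff.2 ⟨⟨le_rfl, zero_le_one⟩, fun w hw hw1 => by
    simpa using hφ.snd_le_one hw hw1⟩

theorem le_one_of_mem_polarQuadrant (hφ : IsPhiTwo φ) {z : ℝ × ℝ} (hz : z ∈ polarQuadrant φ) :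
    z.1 ≤ 1 ∧ z.2 ≤ 1 := by
  rw [hφ.mem_polarQuadrant_iff] at hz
  constructor
  · simpa using hz.2 (1, 0) ⟨zero_le_one, le_rfl⟩ hφ.map_left.le
  · simpa using hz.2 (0, 1) ⟨le_rfl, zero_le_one⟩ hφ.map_right.le

theorem convex_polarQuadrant : Convex ℝ (polarQuadrant φ) := by
  refine Convex.inter ?_ convex_quadrant
  intro z hz z' hz' a b ha hb hab w hw
  have h1 := mul_le_mul_of_nonneg_left (hz w hw) ha
  have h2 := mul_le_mul_of_nonneg_left (hz' w hw) hb
  simp only [Prod.fst_add, Prod.snd_add, Prod.smul_fst, Prod.smul_snd, smul_eq_mul]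
  nlinarith

theorem isCompact_polarQuadrant (hφ : IsPhiTwo φ) : IsCompact (polarQuadrant φ) := by
  refine (isCompact_Icc (a := ((0 : ℝ), (0 : ℝ))) (b := ((1 : ℝ), (1 : ℝ)))).of_isClosed_subset
    ?_ fun z hz => ⟨hz.2, hφ.le_one_of_mem_polarQuadrant hz⟩
  have h1 : IsClosed (polarSet (J φ)) := by
    simp only [polarSet, ofPred_forall]
    exact isClosed_biInter fun w _ => isClosed_le (by fun_prop) continuous_const
  have h2 : IsClosed quadrant := (isClosed_le continuous_const continuous_fst).inter
    (isClosed_le continuous_const continuous_snd)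
  exact h1.inter h2

/-- The bipolar theorem for `J φ`, restricted to the quadrant. -/
theorem map_le_one_of_forall_polarQuadrant (hφ : IsPhiTwo φ) {w : ℝ × ℝ} (hw : w ∈ quadrant)
    (h : ∀ z ∈ polarQuadrant φ, z.1 * w.1 + z.2 * w.2 ≤ 1) : φ w ≤ 1 := by
  by_contra hlt
  have hwJ : w ∉ J φ := fun hJ => hlt (by
    simpa [abs_of_nonneg hw.1, abs_of_nonneg hw.2] using hφ.mem_J_iff.1 hJ)
  obtain ⟨f, u, hf, hu⟩ := geometric_hahn_banach_closed_point hφ.convex_J hφ.isClosed_J hwJ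
  have hfw : ∀ v : ℝ × ℝ, f v = f (1, 0) * v.1 + f (0, 1) * v.2 := fun v => by
    conv_lhs => rw [show v = v.1 • ((1 : ℝ), (0 : ℝ)) + v.2 • ((0 : ℝ), (1 : ℝ)) by ext <;> simp]
    rw [map_add, map_smul, map_smul, smul_eq_mul, smul_eq_mul]
    ring
  have hu0 : 0 < u := by
    have := hf 0 (hφ.mem_J_iff.2 (by simp [hφ.map_zero]))
    simpa using this
  have hz : (|f (1, 0)| / u, |f (0, 1)| / u) ∈ polarQuadrant φ := by
    refine hφ.mem_polarQuadrant_iff.2 ⟨⟨by positivity, by positivity⟩, fun v hv hv1 => ?_⟩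
    -- Flipping signs in `v` turns the coefficients of `f` into their absolute values.
    have hsign : ∀ c s : ℝ, 0 ≤ s → ∃ s', |s'| = s ∧ c * s' = |c| * s := fun c s hs => by
      rcases le_total 0 c with hc | hc
      · exact ⟨s, abs_of_nonneg hs, by rw [abs_of_nonneg hc]⟩
      · exact ⟨-s, by rw [abs_neg, abs_of_nonneg hs], by rw [abs_of_nonpos hc]; ring⟩
    obtain ⟨s, hs, hs'⟩ := hsign (f (1, 0)) v.1 hv.1
    obtain ⟨t, ht, ht'⟩ := hsign (f (0, 1)) v.2 hv.2
    have hlt := hf (s, t) (hφ.mem_J_iff.2 (by simpa [hs, ht] using hv1))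
    rw [hfw] at hlt
    simp only [hs', ht'] at hlt
    simp only
    rw [div_mul_eq_mul_div, div_mul_eq_mul_div, ← add_div, div_le_one hu0]
    exact hlt.le
  have h1 := h _ hz
  simp only at h1
  rw [div_mul_eq_mul_div, div_mul_eq_mul_div, ← add_div, div_le_one hu0] at h1
  rw [hfw] at hu
  have h2 := mul_le_mul_of_nonneg_right (le_abs_self (f (1, 0))) hw.1
  have h3 := mul_le_mul_of_nonneg_right (le_abs_self (f (0, 1))) hw.2
  linarith

theorem upperArc_subset : upperArc φ ⊆ polarQuadrant φ := fun _ hz => hz.prop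

theorem exists_upperArc_ge (hφ : IsPhiTwo φ) {z : ℝ × ℝ} (hz : z ∈ polarQuadrant φ) :
    ∃ p ∈ upperArc φ, z ≤ p := by
  have hc : IsCompact (polarQuadrant φ ∩ Ici z) := hφ.isCompact_polarQuadrant.inter_right isClosed_Ici
  obtain ⟨p, hp, hmax⟩ := hc.exists_isMaxOn ⟨z, hz, le_refl z⟩
    (f := fun q : ℝ × ℝ => q.1 + q.2) (by fun_prop)
  refine ⟨p, ⟨hp.1, fun q hq hpq => ?_⟩, hp.2⟩
  have h1 : q.1 + q.2 ≤ p.1 + p.2 := hmax ⟨hq, (mem_Ici.1 hp.2).trans hpq⟩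
  exact ⟨by linarith [hpq.2], by linarith [hpq.1]⟩

theorem map_le_one_of_forall_upperArc (hφ : IsPhiTwo φ) {w : ℝ × ℝ} (hw : w ∈ quadrant)
    (h : ∀ z ∈ upperArc φ, z.1 * w.1 + z.2 * w.2 ≤ 1) : φ w ≤ 1 :=
  hφ.map_le_one_of_forall_polarQuadrant hw fun z hz => by
    obtain ⟨p, hp, hzp⟩ := hφ.exists_upperArc_ge hz
    exact (add_le_add (mul_le_mul_of_nonneg_right hzp.1 hw.1)
      (mul_le_mul_of_nonneg_right hzp.2 hw.2)).trans (h p hp)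

/-- Being dominated within `polarQuadrant φ` is an open condition: moving the dominating point
slightly towards `(0, 1)` or `(1, 0)` makes the domination strict in both coordinates, unless one
coordinate already has its largest possible value `1`. -/
theorem isCompact_upperArc (hφ : IsPhiTwo φ) : IsCompact (upperArc φ) := by
  refine hφ.isCompact_polarQuadrant.of_isClosed_subset ?_ upperArc_subset
  refine isClosed_of_closure_subset fun z hz => ?_
  have hzM : z ∈ polarQuadrant φ :=
    closure_minimal upperArc_subset hφ.isCompact_polarQuadrant.isClosed hz
  have hfreq := mem_closure_iff_frequently.1 hz
  refine ⟨hzM, fun q hq hzq => ?_⟩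
  have hz1 := hφ.le_one_of_mem_polarQuadrant hzM
  constructor
  · by_contra hlt
    rw [not_le] at hlt
    obtain ⟨p, hpM, hp1, hp2⟩ : ∃ p ∈ polarQuadrant φ, z.1 < p.1 ∧ (z.2 < p.2 ∨ 1 ≤ p.2) := by
      rcases hz1.2.eq_or_lt with h1 | h1
      · exact ⟨q, hq, hlt, Or.inr (h1 ▸ hzq.2)⟩
      · have hq0 : 0 < q.1 := hzM.2.1.trans_lt hlt
        set ε := (q.1 - z.1) / (2 * q.1) with hε
        have hε0 : 0 < ε := div_pos (by linarith) (by linarith)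
        have hεq : ε * q.1 = (q.1 - z.1) / 2 := by rw [hε]; field_simp
        have hε1 : ε ≤ 1 := by
          rw [hε, div_le_one (by linarith)]
          linarith [hzM.2.1]
        refine ⟨_, convex_polarQuadrant hq hφ.zero_one_mem_polarQuadrant (sub_nonneg.2 hε1) hε0.le
          (by ring), ?_, Or.inl ?_⟩
        · simp only [Prod.fst_add, Prod.smul_fst, smul_eq_mul]
          nlinarith
        · simp only [Prod.snd_add, Prod.smul_snd, smul_eq_mul]
          nlinarith [hzq.2]
    have hev : ∀ᶠ u in 𝓝 z, u.1 < p.1 ∧ (u.2 < p.2 ∨ 1 ≤ p.2) :=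
      (continuous_fst.continuousAt.eventually_lt_const hp1).and (by
        rcases hp2 with h | h
        · exact (continuous_snd.continuousAt.eventually_lt_const h).mono fun u hu => Or.inl hu
        · exact Filter.Eventually.of_forall fun u => Or.inr h)
    obtain ⟨u, hu, hu1, hu2⟩ := (hfreq.and_eventually hev).exists
    have hle : u ≤ p := ⟨hu1.le, hu2.elim le_of_lt
      ((hφ.le_one_of_mem_polarQuadrant hu.prop).2.trans)⟩
    exact absurd (hu.2 hpM hle).1 (not_le.2 hu1)
  · by_contra hlt
    rw [not_le] at hlt
    obtain ⟨p, hpM, hp1, hp2⟩ : ∃ p ∈ polarQuadrant φ, z.2 < p.2 ∧ (z.1 < p.1 ∨ 1 ≤ p.1) := by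
      rcases hz1.1.eq_or_lt with h1 | h1
      · exact ⟨q, hq, hlt, Or.inr (h1 ▸ hzq.1)⟩
      · have hq0 : 0 < q.2 := hzM.2.2.trans_lt hlt
        set ε := (q.2 - z.2) / (2 * q.2) with hε
        have hε0 : 0 < ε := div_pos (by linarith) (by linarith)
        have hεq : ε * q.2 = (q.2 - z.2) / 2 := by rw [hε]; field_simp
        have hε1 : ε ≤ 1 := by
          rw [hε, div_le_one (by linarith)]
          linarith [hzM.2.2]
        refine ⟨_, convex_polarQuadrant hq hφ.one_zero_mem_polarQuadrant (sub_nonneg.2 hε1) hε0.le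
          (by ring), ?_, Or.inl ?_⟩
        · simp only [Prod.snd_add, Prod.smul_snd, smul_eq_mul]
          nlinarith
        · simp only [Prod.fst_add, Prod.smul_fst, smul_eq_mul]
          nlinarith [hzq.1]
    have hev : ∀ᶠ u in 𝓝 z, u.2 < p.2 ∧ (u.1 < p.1 ∨ 1 ≤ p.1) :=
      (continuous_snd.continuousAt.eventually_lt_const hp1).and (by
        rcases hp2 with h | h
        · exact (continuous_fst.continuousAt.eventually_lt_const h).mono fun u hu => Or.inl hu
        · exact Filter.Eventually.of_forall fun u => Or.inr h)
    obtain ⟨u, hu, hu1, hu2⟩ := (hfreq.and_eventually hev).exists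
    have hle : u ≤ p := ⟨hu2.elim le_of_lt
      ((hφ.le_one_of_mem_polarQuadrant hu.prop).1.trans), hu1.le⟩
    exact absurd (hu.2 hpM hle).2 (not_le.2 hu1)

/-- Strict convexity of `φ` makes `J φ` smooth from the polar side: a point `z` of the polar set
has at most one `w` in the quadrant with `φ w ≤ 1` at which the pairing attains its bound `1`. -/
theorem eq_of_pairing_eq_one (hφ : IsPhiTwo φ) (hs : StrictConvexOn ℝ quadrant φ) {z w w' : ℝ × ℝ}
    (hz : z ∈ polarQuadrant φ) (hw : w ∈ quadrant) (hw' : w' ∈ quadrant) (h : φ w ≤ 1)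
    (h' : φ w' ≤ 1) (e : z.1 * w.1 + z.2 * w.2 = 1) (e' : z.1 * w'.1 + z.2 * w'.2 = 1) :
    w = w' := by
  by_contra hne
  have hlt := hs.2 hw hw' hne (show (0 : ℝ) < 1 / 2 by norm_num) (show (0 : ℝ) < 1 / 2 by norm_num)
    (by norm_num)
  have hmem := convex_quadrant hw hw' (show (0 : ℝ) ≤ 1 / 2 by norm_num)
    (show (0 : ℝ) ≤ 1 / 2 by norm_num) (by norm_num)
  simp only [smul_eq_mul] at hlt
  obtain ⟨r, hr1, hr⟩ := hφ.exists_one_lt_map_smul_le hmem (by linarith)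
  have := (hφ.mem_polarQuadrant_iff.1 hz).2 _ (smul_mem_quadrant (by linarith) hmem) hr
  simp only [Prod.smul_fst, Prod.smul_snd, Prod.fst_add, Prod.snd_add, smul_eq_mul] at this
  have e3 : z.1 * (r * (1 / 2 * w.1 + 1 / 2 * w'.1)) + z.2 * (r * (1 / 2 * w.2 + 1 / 2 * w'.2)) =
      r := by linear_combination r / 2 * e + r / 2 * e'
  linarith

end IsPhiTwo

/-! ### Representation of the polar set by two convex functions -/

/-- The abstract properties of `polarQuadrant φ` that make it of the form `ψ₁ + ψ₂ ≤ 1`: a compact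
convex subset of the unit square containing `(1, 0)` and `(0, 1)` but not `(1, 1)`, and containing
with each point all smaller points of the quadrant. -/
structure IsCorner (M : Set (ℝ × ℝ)) : Prop where
  compact : IsCompact M
  convex : Convex ℝ M
  subset : M ⊆ quadrant
  lower : ∀ z ∈ M, ∀ z' ∈ quadrant, z' ≤ z → z' ∈ M
  le_one : ∀ z ∈ M, z.1 ≤ 1 ∧ z.2 ≤ 1
  one_zero : (1, 0) ∈ M
  zero_one : (0, 1) ∈ M
  one_one : (1, 1) ∉ M

/-- `cornerMax M x` is the largest value of `z.1 + z.2` for `z ∈ M` with `z.1 ≤ x`. -/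
noncomputable def cornerMax (M : Set (ℝ × ℝ)) (x : ℝ) : ℝ :=
  sSup ((fun z : ℝ × ℝ => z.1 + z.2) '' (M ∩ {z | z.1 ≤ x}))

/-- The function `ψ₁` of the representation of `M`; the function `ψ₂` is the same with the
coordinates swapped. It is affine to the right of a point of `M` with maximal coordinate sum, which
keeps it finite beyond `1` even where the boundary of `M` has a vertical tangent. -/
noncomputable def cornerPsi (M : Set (ℝ × ℝ)) (x : ℝ) : ℝ :=
  (1 + x - cornerMax M x) / (2 - cornerMax M 1)

namespace IsCorner

variable {M : Set (ℝ × ℝ)}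

theorem swap (hM : IsCorner M) : IsCorner (Prod.swap ⁻¹' M) where
  compact := by
    have := hM.compact.image continuous_swap
    rwa [image_swap_eq_preimage_swap] at this
  convex := by
    intro z hz w hw a b ha hb hab
    exact hM.convex hz hw ha hb hab
  subset := fun z hz => ⟨(hM.subset hz).2, (hM.subset hz).1⟩
  lower := fun z hz z' hz' hle => hM.lower _ hz _ ⟨hz'.2, hz'.1⟩ ⟨hle.2, hle.1⟩
  le_one := fun z hz => ⟨(hM.le_one _ hz).2, (hM.le_one _ hz).1⟩
  one_zero := hM.zero_one
  zero_one := hM.one_zero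
  one_one := hM.one_one

theorem cornerMax_spec (hM : IsCorner M) {x : ℝ} (hx : 0 ≤ x) :
    (∃ z ∈ M, z.1 ≤ x ∧ z.1 + z.2 = cornerMax M x) ∧
      ∀ z ∈ M, z.1 ≤ x → z.1 + z.2 ≤ cornerMax M x := by
  have hc : IsCompact ((fun z : ℝ × ℝ => z.1 + z.2) '' (M ∩ {z | z.1 ≤ x})) :=
    (hM.compact.inter_right (isClosed_le continuous_fst continuous_const)).image (by fun_prop)
  constructor
  · obtain ⟨z, hz, hz'⟩ := hc.sSup_mem ⟨_, (0, 1), ⟨hM.zero_one, hx⟩, rfl⟩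
    exact ⟨z, hz.1, hz.2, hz'⟩
  · exact fun z hz hzx => le_csSup hc.bddAbove ⟨z, ⟨hz, hzx⟩, rfl⟩

theorem add_le_cornerMax_one (hM : IsCorner M) {z : ℝ × ℝ} (hz : z ∈ M) :
    z.1 + z.2 ≤ cornerMax M 1 :=
  (hM.cornerMax_spec zero_le_one).2 z hz (hM.le_one z hz).1

theorem cornerMax_le (hM : IsCorner M) {x : ℝ} (hx : 0 ≤ x) : cornerMax M x ≤ cornerMax M 1 := by
  obtain ⟨z, hz, -, h⟩ := (hM.cornerMax_spec hx).1
  exact h ▸ hM.add_le_cornerMax_one hz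

theorem cornerMax_swap_one (hM : IsCorner M) :
    cornerMax (Prod.swap ⁻¹' M) 1 = cornerMax M 1 := by
  obtain ⟨z, hz, -, h⟩ := (hM.cornerMax_spec zero_le_one).1
  obtain ⟨w, hw, -, h'⟩ := (hM.swap.cornerMax_spec zero_le_one).1
  have h1 := hM.add_le_cornerMax_one hw
  have h2 := hM.swap.add_le_cornerMax_one (z := z.swap) (by simpa using hz)
  simp only [Prod.fst_swap, Prod.snd_swap] at h1 h2
  exact le_antisymm (by linarith) (by linarith)

theorem cornerMax_one_lt_two (hM : IsCorner M) : cornerMax M 1 < 2 := by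
  obtain ⟨z, hz, -, h⟩ := (hM.cornerMax_spec zero_le_one).1
  have h1 := hM.le_one z hz
  by_contra hlt
  have e1 : z.1 = 1 := by linarith [h1.1, h1.2]
  have e2 : z.2 = 1 := by linarith [h1.1, h1.2]
  exact hM.one_one (by rwa [show ((1 : ℝ), (1 : ℝ)) = z from Prod.ext e1.symm e2.symm])

theorem cornerMax_zero (hM : IsCorner M) : cornerMax M 0 = 1 := by
  obtain ⟨z, hz, hz0, h⟩ := (hM.cornerMax_spec le_rfl).1
  have h1 := (hM.cornerMax_spec le_rfl).2 _ hM.zero_one le_rfl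
  simp only at h1
  linarith [(hM.le_one z hz).2]

theorem isPhiOne_cornerPsi (hM : IsCorner M) : IsPhiOne (cornerPsi M) := by
  have hd : 0 < 2 - cornerMax M 1 := sub_pos.2 hM.cornerMax_one_lt_two
  have hmono : MonotoneOn (cornerPsi M) (Ici 0) := by
    intro x hx x' hx' hxx'
    obtain ⟨z, hz, hzx, h⟩ := (hM.cornerMax_spec hx').1
    have hq := hM.subset hz
    have h1 := (hM.cornerMax_spec hx).2 (min z.1 x, z.2)
      (hM.lower z hz _ ⟨le_min hq.1 hx, hq.2⟩ ⟨min_le_left _ _, le_rfl⟩) (min_le_right _ _)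
    simp only at h1
    have h2 : z.1 - (x' - x) ≤ min z.1 x := le_min (by linarith) (by linarith)
    exact div_le_div_of_nonneg_right (by linarith) hd.le
  have hzero : cornerPsi M 0 = 0 := by simp [cornerPsi, hM.cornerMax_zero]
  refine ⟨⟨convex_Ici 0, ?_⟩, fun s hs => ?_, hmono, hzero, ?_⟩
  · intro x hx y hy a b ha hb hab
    obtain ⟨z, hz, hzx, h⟩ := (hM.cornerMax_spec hx).1
    obtain ⟨w, hw, hwy, h'⟩ := (hM.cornerMax_spec hy).1
    have h1 := (hM.cornerMax_spec (add_nonneg (mul_nonneg ha hx) (mul_nonneg hb hy))).2 _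
      (hM.convex hz hw ha hb hab) (by
        simp only [Prod.fst_add, Prod.smul_fst, smul_eq_mul]
        exact add_le_add (mul_le_mul_of_nonneg_left hzx ha) (mul_le_mul_of_nonneg_left hwy hb))
    simp only [Prod.fst_add, Prod.smul_fst, Prod.snd_add, Prod.smul_snd, smul_eq_mul] at h1
    simp only [cornerPsi, smul_eq_mul]
    rw [mul_div_assoc', mul_div_assoc', ← add_div]
    refine div_le_div_of_nonneg_right ?_ hd.le
    have e1 : a * cornerMax M x = a * z.1 + a * z.2 := by rw [← h]; ring
    have e2 : b * cornerMax M y = b * w.1 + b * w.2 := by rw [← h']; ring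
    nlinarith
  · rw [← hzero]
    exact hmono self_mem_Ici hs hs
  · rw [cornerPsi, div_eq_one_iff_eq hd.ne']
    ring

theorem mem_of_lt_of_add_le (hM : IsCorner M) {x y : ℝ} (hx : 0 ≤ x) (hy : 0 ≤ y) {z₀ : ℝ × ℝ}
    (hz₀ : z₀ ∈ M) (hmax : z₀.1 + z₀.2 = cornerMax M 1) (hxz : x < z₀.1)
    (h : x + y ≤ cornerMax M x) : (x, y) ∈ M := by
  obtain ⟨z, hz, hzx, hzm⟩ := (hM.cornerMax_spec hx).1
  have hd : 0 < z₀.1 - z.1 := by linarith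
  have hle := hM.cornerMax_le hx
  set θ := (x - z.1) / (z₀.1 - z.1) with hθ
  have hθ0 : 0 ≤ θ := div_nonneg (by linarith) hd.le
  have hθ1 : θ ≤ 1 := (div_le_one hd).2 (by linarith)
  have hw := hM.convex hz hz₀ (sub_nonneg.2 hθ1) hθ0 (by ring)
  have hθx : θ * (z₀.1 - z.1) = x - z.1 := div_mul_cancel₀ _ hd.ne'
  refine hM.lower _ hw _ ⟨hx, hy⟩ ⟨?_, ?_⟩
  · simp only [Prod.fst_add, Prod.smul_fst, smul_eq_mul]
    linarith
  · simp only [Prod.snd_add, Prod.smul_snd, smul_eq_mul]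
    nlinarith

/-- Let `z` be a point of `M` with maximal coordinate sum. If `x < z.1`, then `cornerMax M x` is the
coordinate sum of the highest point of `M` with abscissa `x`, and the inequality compares `y` with
its height; the case `y < z.2` is symmetric. If `x ≥ z.1` and `y ≥ z.2`, then both maxima on the
right equal `cornerMax M 1`, and only `(x, y) = z` satisfies the inequality. -/
theorem mem_iff (hM : IsCorner M) {x y : ℝ} (hx : 0 ≤ x) (hy : 0 ≤ y) : (x, y) ∈ M ↔
    x + y + cornerMax M 1 ≤ cornerMax M x + cornerMax (Prod.swap ⁻¹' M) y := by
  obtain ⟨z, hz, -, hmax⟩ := (hM.cornerMax_spec zero_le_one).1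
  have hq := hM.subset hz
  have hsx := (hM.cornerMax_spec hx).2
  have hsy := (hM.swap.cornerMax_spec hy).2
  have hlx := hM.cornerMax_le hx
  have hly := hM.swap.cornerMax_le hy
  rw [hM.cornerMax_swap_one] at hly
  have hzx : z.1 ≤ x → cornerMax M x = cornerMax M 1 := fun h =>
    le_antisymm hlx (hmax ▸ hsx z hz h)
  have hzy : z.2 ≤ y → cornerMax (Prod.swap ⁻¹' M) y = cornerMax M 1 := fun h =>
    le_antisymm hly (by
      have := hsy z.swap (by simpa using hz) h
      simp only [Prod.fst_swap, Prod.snd_swap] at this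
      linarith)
  constructor
  · intro h
    have h1 := hsx _ h le_rfl
    have h2 := hsy (y, x) h le_rfl
    simp only at h1 h2
    rcases le_or_gt z.1 x with hx' | hx' <;> rcases le_or_gt z.2 y with hy' | hy'
    · rw [hzx hx', hzy hy']
      linarith [hM.add_le_cornerMax_one h]
    · rw [hzx hx']; linarith
    · rw [hzy hy']; linarith
    · have h3 := hsx (x, z.2) (hM.lower z hz _ ⟨hx, hq.2⟩ ⟨hx'.le, le_rfl⟩) le_rfl
      have h4 := hsy (y, z.1) (hM.lower z hz _ ⟨hq.1, hy⟩ ⟨le_rfl, hy'.le⟩) le_rfl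
      simp only at h3 h4
      linarith
  · intro h
    rcases lt_or_ge x z.1 with hx' | hx'
    · exact hM.mem_of_lt_of_add_le hx hy hz hmax hx' (by linarith)
    rcases lt_or_ge y z.2 with hy' | hy'
    · exact hM.swap.mem_of_lt_of_add_le hy hx (z₀ := z.swap) (by simpa using hz)
        (by rw [hM.cornerMax_swap_one]; simpa [add_comm] using hmax) hy' (by linarith)
    · have e1 : x = z.1 := by linarith
      have e2 : y = z.2 := by linarith
      rw [e1, e2]
      exact hz

end IsCorner

namespace IsPhiOne

variable {ψ : ℝ → ℝ}

theorem continuousOn (hψ : IsPhiOne ψ) : ContinuousOn ψ (Ici 0) := by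
  intro s hs
  rcases (mem_Ici.1 hs).eq_or_lt with rfl | hs
  · have hle : ∀ᶠ s in 𝓝[Ici 0] (0 : ℝ), ψ s ≤ s := by
      filter_upwards [self_mem_nhdsWithin, mem_nhdsWithin_of_mem_nhds (Iic_mem_nhds one_pos)]
        with s hs hs1
      have := hψ.convex.2 (show (0 : ℝ) ∈ Ici (0 : ℝ) from self_mem_Ici)
        (show (1 : ℝ) ∈ Ici (0 : ℝ) from mem_Ici.2 zero_le_one)
        (sub_nonneg.2 hs1) hs (by ring)
      simpa [hψ.map_zero, hψ.map_one] using this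
    have hge : ∀ᶠ s in 𝓝[Ici 0] (0 : ℝ), 0 ≤ ψ s := by
      filter_upwards [self_mem_nhdsWithin] with s hs using hψ.nonneg s hs
    rw [ContinuousWithinAt, hψ.map_zero]
    exact tendsto_of_tendsto_of_tendsto_of_le_of_le' tendsto_const_nhds
      (continuousWithinAt_id : ContinuousWithinAt id (Ici 0) (0 : ℝ)) hge hle
  · have := hψ.convex.continuousOn_interior
    rw [interior_Ici] at this
    exact (this.continuousAt (Ioi_mem_nhds hs)).continuousWithinAt

theorem lt_one_of_map_eq_zero (hψ : IsPhiOne ψ) {s : ℝ} (h : ψ s = 0) : s < 1 := by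
  by_contra hlt
  have := hψ.mono (show (1 : ℝ) ∈ Ici (0 : ℝ) from mem_Ici.2 zero_le_one)
    (show s ∈ Ici 0 from zero_le_one.trans (not_lt.1 hlt)) (not_lt.1 hlt)
  rw [hψ.map_one, h] at this
  linarith

theorem tau_spec (hψ : IsPhiOne ψ) :
    0 ≤ tau ψ ∧ ψ (tau ψ) = 0 ∧ ∀ s, tau ψ < s → 0 < ψ s := by
  have hbdd : BddAbove {t | 0 ≤ t ∧ ψ t = 0} := ⟨1, fun t ht => (hψ.lt_one_of_map_eq_zero ht.2).le⟩
  have hne : {t | 0 ≤ t ∧ ψ t = 0}.Nonempty := ⟨0, le_rfl, hψ.map_zero⟩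
  have hcl : IsClosed {t | 0 ≤ t ∧ ψ t = 0} :=
    hψ.continuousOn.preimage_isClosed_of_isClosed isClosed_Ici isClosed_singleton (t := {0})
  have hmem := hcl.csSup_mem hne hbdd
  refine ⟨hmem.1, hmem.2, fun s hs => ?_⟩
  have hs0 : 0 ≤ s := hmem.1.trans hs.le
  refine lt_of_le_of_ne (hψ.nonneg s hs0) fun h => ?_
  exact absurd (le_csSup hbdd ⟨hs0, h.symm⟩) (not_le.2 hs)

theorem strictMonoOn (hψ : IsPhiOne ψ) : StrictMonoOn ψ (Ici (tau ψ)) := by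
  obtain ⟨h0, h1, h2⟩ := hψ.tau_spec
  intro s hs s' hs' hlt
  have hpos := h2 s' ((mem_Ici.1 hs).trans_lt hlt)
  have hd : 0 < s' - tau ψ := by linarith [mem_Ici.1 hs]
  set θ := (s' - s) / (s' - tau ψ) with hθ
  have hθ0 : 0 < θ := div_pos (by linarith) hd
  have hθ1 : θ ≤ 1 := (div_le_one hd).2 (by linarith [mem_Ici.1 hs])
  have hθs : θ * (s' - tau ψ) = s' - s := div_mul_cancel₀ _ hd.ne'
  have := hψ.convex.2 (show s' ∈ Ici 0 from h0.trans hs') (show tau ψ ∈ Ici 0 from h0)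
    (sub_nonneg.2 hθ1) hθ0.le (by ring)
  simp only [smul_eq_mul, h1, mul_zero, add_zero] at this
  rw [show (1 - θ) * s' + θ * tau ψ = s by linarith] at this
  nlinarith

theorem hatInv_spec (hψ : IsPhiOne ψ) {s : ℝ} (hs : s ∈ Icc (0 : ℝ) 1) :
    hatInv ψ s ∈ Icc (tau ψ) 1 ∧ ψ (hatInv ψ s) = s := by
  obtain ⟨h0, h1, -⟩ := hψ.tau_spec
  have hex : ∃ a ∈ Icc (tau ψ) 1, ψ a = s := by
    have hle : tau ψ ≤ 1 := (hψ.lt_one_of_map_eq_zero h1).le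
    have := intermediate_value_Icc hle (hψ.continuousOn.mono fun t ht => h0.trans ht.1)
    rw [h1, hψ.map_one] at this
    exact this hs
  exact ⟨Function.invFunOn_mem hex, Function.invFunOn_eq hex⟩

end IsPhiOne

namespace IsPhiTwo

variable {φ : ℝ × ℝ → ℝ}

theorem polarSet_eq_square_iff (hφ : IsPhiTwo φ) :
    polarSet (J φ) = square ↔ (1, 1) ∈ polarQuadrant φ := by
  constructor
  · intro h
    refine ⟨?_, zero_le_one, zero_le_one⟩
    rw [h]
    exact ⟨⟨by norm_num, le_rfl⟩, ⟨by norm_num, le_rfl⟩⟩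
  · intro h
    have hpair := (hφ.mem_polarQuadrant_iff.1 h).2
    have hunit : ∀ s : ℝ, |s| = 1 → (s, 0) ∈ J φ ∧ (0, s) ∈ J φ := fun s hs => by
      constructor <;> rw [hφ.mem_J_iff] <;> simp [hs, hφ.map_left, hφ.map_right]
    ext z
    constructor
    · intro hz
      have a1 := hz _ (hunit 1 (by simp)).1
      have a2 := hz _ (hunit (-1) (by simp)).1
      have a3 := hz _ (hunit 1 (by simp)).2
      have a4 := hz _ (hunit (-1) (by simp)).2
      simp only at a1 a2 a3 a4
      exact ⟨⟨by linarith, by linarith⟩, ⟨by linarith, by linarith⟩⟩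
    · rintro ⟨hz1, hz2⟩ w hw
      have h1 := hpair (|w.1|, |w.2|) ⟨abs_nonneg _, abs_nonneg _⟩ (hφ.mem_J_iff.1 hw)
      simp only [one_mul] at h1
      have h2 : z.1 * w.1 ≤ |w.1| := by
        refine (le_abs_self _).trans ?_
        rw [abs_mul]
        exact mul_le_of_le_one_left (abs_nonneg _) (abs_le.2 hz1)
      have h3 : z.2 * w.2 ≤ |w.2| := by
        refine (le_abs_self _).trans ?_
        rw [abs_mul]
        exact mul_le_of_le_one_left (abs_nonneg _) (abs_le.2 hz2)
      linarith

theorem isCorner (hφ : IsPhiTwo φ) (h : polarSet (J φ) ≠ square) : IsCorner (polarQuadrant φ) where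
  compact := hφ.isCompact_polarQuadrant
  convex := convex_polarQuadrant
  subset := inter_subset_right
  lower := fun _ hz _ hz' hle => hφ.mem_polarQuadrant_of_le hz hz' hle
  le_one := fun _ hz => hφ.le_one_of_mem_polarQuadrant hz
  one_zero := hφ.one_zero_mem_polarQuadrant
  zero_one := hφ.zero_one_mem_polarQuadrant
  one_one := fun h' => h (hφ.polarSet_eq_square_iff.2 h')

/-- A representing pair exists, so the last branch in the definition of `orliczSum` is void. -/
theorem exists_represents (hφ : IsPhiTwo φ) (h : polarSet (J φ) ≠ square) :
    ∃ ψ : (ℝ → ℝ) × (ℝ → ℝ), Represents φ ψ.1 ψ.2 := by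
  have hM := hφ.isCorner h
  refine ⟨(cornerPsi (polarQuadrant φ), cornerPsi (Prod.swap ⁻¹' polarQuadrant φ)),
    hM.isPhiOne_cornerPsi, hM.swap.isPhiOne_cornerPsi, ?_⟩
  have hd : 0 < 2 - cornerMax (polarQuadrant φ) 1 := sub_pos.2 hM.cornerMax_one_lt_two
  have key : ∀ z ∈ quadrant, z ∈ polarQuadrant φ ↔ cornerPsi (polarQuadrant φ) z.1 +
      cornerPsi (Prod.swap ⁻¹' polarQuadrant φ) z.2 ≤ 1 := fun z hz => by
    rw [cornerPsi, cornerPsi, hM.cornerMax_swap_one, ← add_div, div_le_one hd]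
    refine (hM.mem_iff hz.1 hz.2).trans ⟨fun h => by linarith, fun h => by linarith⟩
  ext z
  constructor
  · intro hz
    have h1 := hφ.le_one_of_mem_polarQuadrant hz
    exact ⟨⟨⟨hz.2.1, h1.1⟩, ⟨hz.2.2, h1.2⟩⟩, (key z hz.2).1 hz⟩
  · rintro ⟨⟨hz1, hz2⟩, hz⟩
    exact (key z ⟨hz1.1, hz2.1⟩).2 hz

/-- Whatever pair represents the polar set, the coefficient pairs of the Orlicz sum run through
its upper right boundary. -/
theorem range_hatInv_eq_upperArc {ψ₁ ψ₂ : ℝ → ℝ} (h : Represents φ ψ₁ ψ₂) :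
    (fun t => (hatInv ψ₁ (1 - t), hatInv ψ₂ t)) '' Icc 0 1 = upperArc φ := by
  obtain ⟨h1, h2, hM⟩ := h
  have hmem : ∀ z, z ∈ polarQuadrant φ ↔
      z ∈ Icc (0 : ℝ) 1 ×ˢ Icc (0 : ℝ) 1 ∧ ψ₁ z.1 + ψ₂ z.2 ≤ 1 := fun z => by
    rw [polarQuadrant, hM]; rfl
  have harc : ∀ t ∈ Icc (0 : ℝ) 1, (hatInv ψ₁ (1 - t), hatInv ψ₂ t) ∈ polarQuadrant φ := by
    intro t ht
    obtain ⟨a1, a2⟩ := h1.hatInv_spec (s := 1 - t) ⟨by linarith [ht.2], by linarith [ht.1]⟩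
    obtain ⟨b1, b2⟩ := h2.hatInv_spec ht
    refine (hmem _).2 ⟨⟨⟨h1.tau_spec.1.trans a1.1, a1.2⟩, ⟨h2.tau_spec.1.trans b1.1, b1.2⟩⟩, ?_⟩
    simp only [a2, b2]
    linarith
  ext z
  constructor
  · rintro ⟨t, ht, rfl⟩
    refine ⟨harc t ht, fun z hz hle => ?_⟩
    obtain ⟨a1, a2⟩ := h1.hatInv_spec (s := 1 - t) ⟨by linarith [ht.2], by linarith [ht.1]⟩
    obtain ⟨b1, b2⟩ := h2.hatInv_spec ht
    have hz' := ((hmem z).1 hz).2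
    have c1 := h1.strictMonoOn.monotoneOn a1.1 (a1.1.trans hle.1) hle.1
    have c2 := h2.strictMonoOn.monotoneOn b1.1 (b1.1.trans hle.2) hle.2
    simp only [a2, b2] at c1 c2
    constructor
    · by_contra hlt
      have := h1.strictMonoOn a1.1 (a1.1.trans hle.1) (not_le.1 hlt)
      simp only [a2] at this
      linarith
    · by_contra hlt
      have := h2.strictMonoOn b1.1 (b1.1.trans hle.2) (not_le.1 hlt)
      simp only [b2] at this
      linarith
  · intro hz
    obtain ⟨⟨hz1, hz2⟩, hz3⟩ := (hmem z).1 hz.prop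
    have hn1 := h1.nonneg z.1 hz1.1
    have hn2 := h2.nonneg z.2 hz2.1
    have ht : ψ₂ z.2 ∈ Icc (0 : ℝ) 1 := ⟨hn2, by linarith⟩
    obtain ⟨a1, a2⟩ := h1.hatInv_spec (s := 1 - ψ₂ z.2) ⟨by linarith, by linarith⟩
    obtain ⟨b1, b2⟩ := h2.hatInv_spec ht
    have hle : z ≤ (hatInv ψ₁ (1 - ψ₂ z.2), hatInv ψ₂ (ψ₂ z.2)) := by
      constructor
      · by_contra hlt
        have := h1.strictMonoOn a1.1 (a1.1.trans (not_le.1 hlt).le) (not_le.1 hlt)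
        simp only [a2] at this
        linarith
      · by_contra hlt
        have := h2.strictMonoOn b1.1 (b1.1.trans (not_le.1 hlt).le) (not_le.1 hlt)
        simp only [b2] at this
        linarith
    exact ⟨_, ht, le_antisymm (hz.2 (harc _ ht) hle) hle⟩

/-- The Orlicz sum as a union over the upper right boundary of the polar set. The Minkowski sum is
covered as well: if the polar set is the square, then `(1, 1)` is its only maximal point. -/
theorem orliczSum_eq (hφ : IsPhiTwo φ) (K L : Set (EuclideanSpace ℝ (Fin n))) :
    orliczSum φ K L = {z | ∃ p ∈ upperArc φ, ∃ x ∈ K, ∃ y ∈ L, z = p.1 • x + p.2 • y} := by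
  unfold orliczSum
  split_ifs with hsq hex
  · have h11 := hφ.polarSet_eq_square_iff.1 hsq
    have harc : ∀ p, p ∈ upperArc φ ↔ p = (1, 1) := fun p => by
      constructor
      · intro hp
        have hle := hφ.le_one_of_mem_polarQuadrant hp.prop
        exact le_antisymm hle (hp.2 h11 hle)
      · rintro rfl
        exact ⟨h11, fun q hq _ => hφ.le_one_of_mem_polarQuadrant hq⟩
    ext z
    simp only [harc, mem_ofPred_eq, exists_eq_left, one_smul, mem_add, eq_comm]
  · rw [← range_hatInv_eq_upperArc hex.choose_spec]
    ext z
    simp only [sumVia, mem_ofPred_eq, exists_mem_image]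
    constructor
    · rintro ⟨x, hx, y, hy, t, ht, rfl⟩
      exact ⟨t, ht, x, hx, y, hy, rfl⟩
    · rintro ⟨t, ht, x, hx, y, hy, rfl⟩
      exact ⟨x, hx, y, hy, t, ht, rfl⟩
  · exact absurd (hφ.exists_represents hsq) hex

end IsPhiTwo

/-! ### The Orlicz–Brunn–Minkowski inequality and its equality case -/

theorem V_smul_rpow (hn : n ≠ 0) {c : ℝ} (hc : 0 ≤ c) (A : Set (EuclideanSpace ℝ (Fin n))) :
    V (c • A) ^ (1 / (n : ℝ)) = c * V A ^ (1 / (n : ℝ)) := by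
  rw [V_smul hc, Real.mul_rpow (pow_nonneg hc n) (V_nonneg A), one_div,
    Real.pow_rpow_inv_natCast hc hn]

theorem V_le_of_rpow_le (hn : n ≠ 0) {A B : Set (EuclideanSpace ℝ (Fin n))}
    (h : V A ^ (1 / (n : ℝ)) ≤ V B ^ (1 / (n : ℝ))) : V A ≤ V B := by
  rw [V_eq_radius_pow hn A, V_eq_radius_pow hn B]
  exact pow_le_pow_left₀ (Real.rpow_nonneg (V_nonneg _) _) h n

namespace IsPhiTwo

variable {φ : ℝ × ℝ → ℝ} {K L : Set (EuclideanSpace ℝ (Fin n))}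

theorem isCompact_orliczSum (hφ : IsPhiTwo φ) (hK : IsCompact K) (hL : IsCompact L) :
    IsCompact (orliczSum φ K L) := by
  have himg : orliczSum φ K L = (fun q : (ℝ × ℝ) × EuclideanSpace ℝ (Fin n) ×
      EuclideanSpace ℝ (Fin n) => q.1.1 • q.2.1 + q.1.2 • q.2.2) '' (upperArc φ ×ˢ K ×ˢ L) := by
    rw [hφ.orliczSum_eq]
    ext z
    constructor
    · rintro ⟨p, hp, x, hx, y, hy, rfl⟩
      exact ⟨(p, x, y), ⟨hp, hx, hy⟩, rfl⟩
    · rintro ⟨⟨p, x, y⟩, ⟨hp, hx, hy⟩, rfl⟩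
      exact ⟨p, hp, x, hx, y, hy, rfl⟩
  rw [himg]
  exact (hφ.isCompact_upperArc.prod (hK.prod hL)).image (by fun_prop)

theorem smul_add_smul_subset (hφ : IsPhiTwo φ) {p : ℝ × ℝ} (hp : p ∈ upperArc φ) :
    p.1 • K + p.2 • L ⊆ orliczSum φ K L := by
  rw [hφ.orliczSum_eq]
  rintro _ ⟨_, ⟨x, hx, rfl⟩, _, ⟨y, hy, rfl⟩, rfl⟩
  exact ⟨p, hp, x, hx, y, hy, rfl⟩

theorem radius_smul_add_smul (hn : n ≠ 0) (hK : IsCompact K) (hL : IsCompact L)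
    (hK' : K.Nonempty) (hL' : L.Nonempty) {p : ℝ × ℝ} (hp : p ∈ upperArc φ) :
    p.1 * V K ^ (1 / (n : ℝ)) + p.2 * V L ^ (1 / (n : ℝ)) ≤
      V (p.1 • K + p.2 • L) ^ (1 / (n : ℝ)) := by
  rw [← V_smul_rpow hn hp.prop.2.1, ← V_smul_rpow hn hp.prop.2.2]
  exact brunnMinkowski hn (hK.smul _) (hL.smul _) hK'.smul_set hL'.smul_set

theorem radius_le_orliczSum (hφ : IsPhiTwo φ) (hn : n ≠ 0) (hK : IsCompact K) (hL : IsCompact L)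
    (hK' : K.Nonempty) (hL' : L.Nonempty) {p : ℝ × ℝ} (hp : p ∈ upperArc φ) :
    p.1 * V K ^ (1 / (n : ℝ)) + p.2 * V L ^ (1 / (n : ℝ)) ≤
      V (orliczSum φ K L) ^ (1 / (n : ℝ)) :=
  (radius_smul_add_smul hn hK hL hK' hL' hp).trans (Real.rpow_le_rpow (V_nonneg _)
    (V_mono (hφ.isCompact_orliczSum hK hL) (hφ.smul_add_smul_subset hp)) (by positivity))

theorem exists_upperArc_fst_eq_one (hφ : IsPhiTwo φ) : ∃ p ∈ upperArc φ, p.1 = 1 := by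
  obtain ⟨p, hp, hle⟩ := hφ.exists_upperArc_ge hφ.one_zero_mem_polarQuadrant
  exact ⟨p, hp, le_antisymm (hφ.le_one_of_mem_polarQuadrant hp.prop).1 hle.1⟩

theorem exists_upperArc_snd_eq_one (hφ : IsPhiTwo φ) : ∃ p ∈ upperArc φ, p.2 = 1 := by
  obtain ⟨p, hp, hle⟩ := hφ.exists_upperArc_ge hφ.zero_one_mem_polarQuadrant
  exact ⟨p, hp, le_antisymm (hφ.le_one_of_mem_polarQuadrant hp.prop).2 hle.2⟩

theorem V_orliczSum_pos (hφ : IsPhiTwo φ) (hn : n ≠ 0) (hK : IsCompact K) (hL : IsCompact L)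
    (hVK : 0 < V K) (hVL : 0 < V L) : 0 < V (orliczSum φ K L) := by
  obtain ⟨p, hp, hp1⟩ := hφ.exists_upperArc_fst_eq_one
  have h := hφ.radius_le_orliczSum hn hK hL (nonempty_of_V_pos hVK) (nonempty_of_V_pos hVL) hp
  rw [hp1, one_mul] at h
  have h1 : 0 < V K ^ (1 / (n : ℝ)) := Real.rpow_pos_of_pos hVK _
  have h2 : 0 ≤ p.2 * V L ^ (1 / (n : ℝ)) :=
    mul_nonneg hp.prop.2.2 (Real.rpow_nonneg hVL.le _)
  have h3 : 0 < V (orliczSum φ K L) ^ (1 / (n : ℝ)) := by linarith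
  refine (V_nonneg _).lt_of_ne fun h0 => ?_
  rw [← h0, Real.zero_rpow (by positivity)] at h3
  exact lt_irrefl _ h3

/-- The Orlicz–Brunn–Minkowski inequality, in terms of the volume radii. -/
theorem map_radius_div_le_one (hφ : IsPhiTwo φ) (hn : n ≠ 0) (hK : IsCompact K) (hL : IsCompact L)
    (hVK : 0 < V K) (hVL : 0 < V L) :
    φ (V K ^ (1 / (n : ℝ)) / V (orliczSum φ K L) ^ (1 / (n : ℝ)),
      V L ^ (1 / (n : ℝ)) / V (orliczSum φ K L) ^ (1 / (n : ℝ))) ≤ 1 := by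
  have hs := Real.rpow_pos_of_pos (hφ.V_orliczSum_pos hn hK hL hVK hVL) (1 / (n : ℝ))
  refine hφ.map_le_one_of_forall_upperArc ⟨div_nonneg (Real.rpow_nonneg hVK.le _) hs.le,
    div_nonneg (Real.rpow_nonneg hVL.le _) hs.le⟩ fun p hp => ?_
  simp only
  rw [mul_div_assoc', mul_div_assoc', ← add_div, div_le_one hs]
  exact hφ.radius_le_orliczSum hn hK hL (nonempty_of_V_pos hVK) (nonempty_of_V_pos hVL) hp

/-- For convex dilatates containing the origin the sum is a multiple of `K`. If the value of `φ` were
less than `1`, then the sum would be contained in a multiple of `K` of smaller volume. -/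
theorem map_radius_div_eq_one (hφ : IsPhiTwo φ) (hn : n ≠ 0) (hK : IsCompact K) (hL : IsCompact L)
    (hVK : 0 < V K) (hVL : 0 < V L) (h : IsConvexZeroDilatates K L) :
    φ (V K ^ (1 / (n : ℝ)) / V (orliczSum φ K L) ^ (1 / (n : ℝ)),
      V L ^ (1 / (n : ℝ)) / V (orliczSum φ K L) ^ (1 / (n : ℝ))) = 1 := by
  obtain ⟨hKc, -, hK0, -, c, hc, hLK⟩ := h
  refine le_antisymm (hφ.map_radius_div_le_one hn hK hL hVK hVL) (not_lt.1 fun hlt => ?_)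
  have hs := Real.rpow_pos_of_pos (hφ.V_orliczSum_pos hn hK hL hVK hVL) (1 / (n : ℝ))
  have hk := Real.rpow_pos_of_pos hVK (1 / (n : ℝ))
  have hl : V L ^ (1 / (n : ℝ)) = c * V K ^ (1 / (n : ℝ)) := by rw [hLK, V_smul_rpow hn hc.le]
  set s := V (orliczSum φ K L) ^ (1 / (n : ℝ)) with hsdef
  set k := V K ^ (1 / (n : ℝ)) with hkdef
  rw [hl] at hlt
  have hw : (k / s, c * k / s) ∈ quadrant := ⟨by positivity, by positivity⟩
  obtain ⟨r, hr1, hr⟩ := hφ.exists_one_lt_map_smul_le hw hlt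
  have hr0 : 0 < r := by linarith
  have hd : 0 < s / (r * k) := by positivity
  have hsub : orliczSum φ K L ⊆ (s / (r * k)) • K := by
    rw [hφ.orliczSum_eq]
    rintro _ ⟨p, hp, x, hx, y, hy, rfl⟩
    have hpair := (hφ.mem_polarQuadrant_iff.1 hp.prop).2 _ (smul_mem_quadrant hr0.le hw) hr
    simp only [Prod.smul_mk, smul_eq_mul] at hpair
    have hp1 := hp.prop.2.1
    have hp2 := hp.prop.2.2
    have hle : p.1 + p.2 * c ≤ s / (r * k) := by
      rw [le_div_iff₀ (by positivity)]
      have e : p.1 * (r * (k / s)) + p.2 * (r * (c * k / s)) =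
          (p.1 + p.2 * c) * (r * k) / s := by ring
      rw [e, div_le_one hs] at hpair
      exact hpair
    have hpc : 0 ≤ p.2 * c := mul_nonneg hp2 hc.le
    have hmem : p.1 • x + p.2 • y ∈ (p.1 + p.2 * c) • K := by
      rw [hLK] at hy
      obtain ⟨y', hy', rfl⟩ := hy
      rw [hKc.add_smul hp1 hpc]
      exact ⟨_, ⟨x, hx, rfl⟩, _, ⟨y', hy', rfl⟩, by simp only [smul_smul]⟩
    obtain ⟨u, hu, hu'⟩ := hmem
    rw [← hu']
    refine ⟨((p.1 + p.2 * c) / (s / (r * k))) • u, hKc.smul_mem_of_zero_mem hK0 hu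
      ⟨by positivity, (div_le_one hd).2 hle⟩, ?_⟩
    simp only [smul_smul]
    rw [mul_div_cancel₀ _ hd.ne']
  have hle : s ≤ s / (r * k) * k := by
    rw [hkdef, ← V_smul_rpow hn hd.le, hsdef]
    exact Real.rpow_le_rpow (V_nonneg _) (V_mono (hK.smul _) hsub) (by positivity)
  have e : s / (r * k) * k * r = s := by field_simp
  nlinarith

/-- Equality forces the shape of `K` and `L`. For the maximizing coefficient pair `p₀` there is
equality in the Brunn–Minkowski inequality, hence `K` and `L` are convex, and all the bodies
`p.1 • K + p.2 • L` lie in `p₀.1 • K + p₀.2 • L`. In terms of support functions, `p₀` maximizes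
every pairing with `(h_K(f), h_L(f))`, as it does for the pair of volume radii; strict convexity
of `φ` makes these pairs proportional. -/
theorem isConvexZeroDilatates_of_eq (hφ : IsPhiTwo φ) (hstrict : StrictConvexOn ℝ quadrant φ)
    (hn : n ≠ 0) (hK : IsCompact K) (hL : IsCompact L) (hVK : 0 < V K) (hVL : 0 < V L)
    (heq : φ (V K ^ (1 / (n : ℝ)) / V (orliczSum φ K L) ^ (1 / (n : ℝ)),
      V L ^ (1 / (n : ℝ)) / V (orliczSum φ K L) ^ (1 / (n : ℝ))) = 1) :
    IsConvexZeroDilatates K L := by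
  have hK' := nonempty_of_V_pos hVK
  have hL' := nonempty_of_V_pos hVL
  have hSc := hφ.isCompact_orliczSum hK hL
  have hs := Real.rpow_pos_of_pos (hφ.V_orliczSum_pos hn hK hL hVK hVL) (1 / (n : ℝ))
  have hk := Real.rpow_pos_of_pos hVK (1 / (n : ℝ))
  have hl := Real.rpow_pos_of_pos hVL (1 / (n : ℝ))
  have hrad : ∀ p ∈ upperArc φ, _ := fun p hp => hφ.radius_le_orliczSum hn hK hL hK' hL' hp
  have hradp : ∀ p ∈ upperArc φ, _ := fun p hp => radius_smul_add_smul hn hK hL hK' hL' hp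
  set s := V (orliczSum φ K L) ^ (1 / (n : ℝ)) with hsdef
  set k := V K ^ (1 / (n : ℝ)) with hkdef
  set l := V L ^ (1 / (n : ℝ)) with hldef
  have hnonneg : ∀ p ∈ upperArc φ, 0 ≤ p.1 ∧ 0 ≤ p.2 := fun p hp => hp.prop.2
  obtain ⟨pa, hpa, hpa1⟩ := hφ.exists_upperArc_fst_eq_one
  obtain ⟨pb, hpb, hpb1⟩ := hφ.exists_upperArc_snd_eq_one
  obtain ⟨p₀, hp₀, hmax⟩ := hφ.isCompact_upperArc.exists_isMaxOn ⟨pa, hpa⟩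
    (f := fun p : ℝ × ℝ => p.1 * k + p.2 * l) (by fun_prop)
  have hmax' : ∀ p ∈ upperArc φ, p.1 * k + p.2 * l ≤ p₀.1 * k + p₀.2 * l := fun p hp => hmax hp
  have hw : (k / s, l / s) ∈ quadrant := ⟨by positivity, by positivity⟩
  have hh : p₀.1 * k + p₀.2 * l = s := by
    refine le_antisymm (hrad p₀ hp₀) (not_lt.1 fun hlt => ?_)
    set h := p₀.1 * k + p₀.2 * l with hdef
    have hh0 : 0 < h := by
      have := hmax' pa hpa
      rw [hpa1, one_mul] at this
      have := mul_nonneg (hnonneg pa hpa).2 hl.le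
      linarith
    have hq : (k / h, l / h) ∈ quadrant := ⟨by positivity, by positivity⟩
    have h1 : φ (k / h, l / h) ≤ 1 := by
      refine hφ.map_le_one_of_forall_upperArc hq fun p hp => ?_
      simp only
      rw [mul_div_assoc', mul_div_assoc', ← add_div, div_le_one hh0]
      exact hmax' p hp
    have h2 := hφ.map_smul_le hq (r := h / s) (by positivity) ((div_le_one hs).2 hlt.le)
    rw [show (h / s) • (k / h, l / h) = (k / s, l / s) by
      ext <;> simp only [Prod.smul_mk, smul_eq_mul] <;> field_simp, heq] at h2
    have h3 : h / s < 1 := (div_lt_one hs).2 hlt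
    have h4 : 0 < h / s := by positivity
    nlinarith
  have hpairing : ∀ p : ℝ × ℝ, p.1 * k + p.2 * l = s →
      p.1 * (k / s) + p.2 * (l / s) = 1 := fun p hp => by
    rw [mul_div_assoc', mul_div_assoc', ← add_div, hp, div_self hs.ne']
  -- A point of the arc with a coordinate equal to `1` pairs to `1` with a coordinate vector already,
  -- so by uniqueness it is not a maximizer.
  have hlt1 : ∀ p ∈ upperArc φ, p.1 = 1 → p.1 * k + p.2 * l < s := fun p hp hp1 => by
    refine lt_of_le_of_ne (hrad p hp) fun he => ?_
    have := hφ.eq_of_pairing_eq_one hstrict hp.prop hw (w' := (1, 0)) ⟨zero_le_one, le_rfl⟩ heq.le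
      hφ.map_left.le (hpairing p he) (by simp [hp1])
    have h2 : l / s = 0 := congrArg Prod.snd this
    exact absurd h2 (by positivity)
  have hlt2 : ∀ p ∈ upperArc φ, p.2 = 1 → p.1 * k + p.2 * l < s := fun p hp hp1 => by
    refine lt_of_le_of_ne (hrad p hp) fun he => ?_
    have := hφ.eq_of_pairing_eq_one hstrict hp.prop hw (w' := (0, 1)) ⟨le_rfl, zero_le_one⟩ heq.le
      hφ.map_right.le (hpairing p he) (by simp [hp1])
    have h2 : k / s = 0 := congrArg Prod.fst this
    exact absurd h2 (by positivity)
  have hle1 := hφ.le_one_of_mem_polarQuadrant hp₀.prop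
  have hp₀1 : 0 < p₀.1 := by
    refine lt_of_le_of_ne (hnonneg _ hp₀).1 fun h0 => ?_
    have h1 := hlt2 pb hpb hpb1
    rw [← hh, ← h0, hpb1] at h1
    nlinarith [mul_nonneg (hnonneg _ hpb).1 hk.le, mul_le_mul_of_nonneg_right hle1.2 hl.le]
  have hp₀2 : 0 < p₀.2 := by
    refine lt_of_le_of_ne (hnonneg _ hp₀).2 fun h0 => ?_
    have h1 := hlt1 pa hpa hpa1
    rw [← hh, ← h0, hpa1] at h1
    nlinarith [mul_nonneg (hnonneg _ hpa).2 hl.le, mul_le_mul_of_nonneg_right hle1.1 hk.le]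
  have hbm : IsBrunnMinkowskiEq (p₀.1 • K) (p₀.2 • L) := by
    refine ⟨hK.smul _, hL.smul _, ?_, ?_, ?_⟩
    · rw [V_smul hp₀1.le]; positivity
    · rw [V_smul hp₀2.le]; positivity
    · rw [V_smul_rpow hn hp₀1.le, V_smul_rpow hn hp₀2.le, hh]
      exact Real.rpow_le_rpow (V_nonneg _) (V_mono hSc (hφ.smul_add_smul_subset hp₀))
        (by positivity)
  have hconv : ∀ {c : ℝ} {A : Set (EuclideanSpace ℝ (Fin n))}, 0 < c → Convex ℝ (c • A) →
      Convex ℝ A := fun {c A} hc h => by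
    have := h.smul c⁻¹
    rwa [smul_smul, inv_mul_cancel₀ hc.ne', one_smul] at this
  have hKc : Convex ℝ K := hconv hp₀1 (hbm.convex_left hn)
  have hLc : Convex ℝ L := hconv hp₀2 (hbm.symm.convex_left hn)
  have hVle : V (orliczSum φ K L) ≤ V (p₀.1 • K + p₀.2 • L) := by
    refine V_le_of_rpow_le hn ?_
    rw [← hsdef, ← hh]
    exact hradp p₀ hp₀
  have hsub : ∀ p ∈ upperArc φ, p.1 • K + p.2 • L ⊆ p₀.1 • K + p₀.2 • L := fun p hp => by
    refine subset_of_V_le_of_convex hSc ((hK.smul _).add (hL.smul _))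
      (hφ.smul_add_smul_subset hp₀) hVle ((hKc.smul _).add (hLc.smul _))
      (hφ.smul_add_smul_subset hp) ?_
    have hpos : 0 < p.1 * k + p.2 * l := by
      obtain ⟨h1, h2⟩ := hnonneg p hp
      rcases h1.eq_or_lt with h1' | h1'
      · rcases h2.eq_or_lt with h2' | h2'
        · have hle := hp.2 hφ.one_zero_mem_polarQuadrant ⟨by simp [← h1'], by simp [← h2']⟩
          have : (1 : ℝ) ≤ p.1 := hle.1
          linarith
        · positivity
      · positivity
    have h3 := hpos.trans_le (hradp p hp)
    rw [pos_iff_ne_zero]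
    intro h0
    rw [V, h0, ENNReal.toReal_zero, Real.zero_rpow (by positivity)] at h3
    exact lt_irrefl _ h3
  have hsupp : ∀ f : EuclideanSpace ℝ (Fin n) →L[ℝ] ℝ, ∃ x ∈ K, ∃ y ∈ L, ∃ c : ℝ, 0 ≤ c ∧
      (∀ x' ∈ K, f x' ≤ f x) ∧ (∀ y' ∈ L, f y' ≤ f y) ∧ f x = c * k ∧ f y = c * l := by
    intro f
    obtain ⟨x, hx, hxmax⟩ := hK.exists_isMaxOn hK' f.continuous.continuousOn
    obtain ⟨y, hy, hymax⟩ := hL.exists_isMaxOn hL' f.continuous.continuousOn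
    have hdom : ∀ p ∈ upperArc φ, p.1 * f x + p.2 * f y ≤ p₀.1 * f x + p₀.2 * f y := by
      intro p hp
      obtain ⟨_, ⟨x', hx', rfl⟩, _, ⟨y', hy', rfl⟩, hxy⟩ :=
        hsub p hp ⟨_, ⟨x, hx, rfl⟩, _, ⟨y, hy, rfl⟩, rfl⟩
      have e : p₀.1 * f x' + p₀.2 * f y' = p.1 * f x + p.2 * f y := by
        simpa using congrArg f hxy
      rw [← e]
      exact add_le_add (mul_le_mul_of_nonneg_left (hxmax hx') hp₀1.le)
        (mul_le_mul_of_nonneg_left (hymax hy') hp₀2.le)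
    -- Adding a large multiple of `(k, l)` moves the pair of support values into the quadrant.
    set r := |f x| / k + |f y| / l + 1 with hr
    have hrk : 0 < f x + r * k := by
      have e : r * k = |f x| + |f y| / l * k + k := by rw [hr]; field_simp
      have : 0 ≤ |f y| / l * k := by positivity
      linarith [neg_abs_le (f x)]
    have hrl : 0 < f y + r * l := by
      have e : r * l = |f x| / k * l + |f y| + l := by rw [hr]; field_simp
      have : 0 ≤ |f x| / k * l := by positivity
      linarith [neg_abs_le (f y)]
    set H := p₀.1 * (f x + r * k) + p₀.2 * (f y + r * l) with hH
    have hH0 : 0 < H := by positivity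
    have hr0 : 0 < r := by positivity
    have hq : ((f x + r * k) / H, (f y + r * l) / H) ∈ quadrant :=
      ⟨by positivity, by positivity⟩
    have hφq : φ ((f x + r * k) / H, (f y + r * l) / H) ≤ 1 := by
      refine hφ.map_le_one_of_forall_upperArc hq fun p hp => ?_
      simp only
      rw [mul_div_assoc', mul_div_assoc', ← add_div, div_le_one hH0]
      have h1 := mul_le_mul_of_nonneg_left (hmax' p hp) hr0.le
      have h2 := hdom p hp
      rw [hH]
      nlinarith
    have hqeq := hφ.eq_of_pairing_eq_one hstrict hp₀.prop hq hw hφq heq.le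
      (by
        simp only
        rw [mul_div_assoc', mul_div_assoc', ← add_div, ← hH, div_self hH0.ne'])
      (hpairing p₀ hh)
    have e1 : (f x + r * k) / H = k / s := congrArg Prod.fst hqeq
    have e2 : (f y + r * l) / H = l / s := congrArg Prod.snd hqeq
    have e1' : f x = (H / s - r) * k := by
      field_simp at e1 ⊢
      linarith
    have e2' : f y = (H / s - r) * l := by
      field_simp at e2 ⊢
      linarith
    refine ⟨x, hx, y, hy, H / s - r, ?_, fun x' hx' => hxmax hx', fun y' hy' => hymax hy', e1', e2'⟩
    -- A negative factor would make `p₀` a minimizer as well, so the pairing would be constant.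
    by_contra hneg
    rw [not_le] at hneg
    have h1 := hdom pa hpa
    rw [e1', e2'] at h1
    have h2 := hlt1 pa hpa hpa1
    rw [← hh] at h2
    nlinarith [mul_lt_mul_of_neg_left h2 hneg]
  have hzero : ∀ {A : Set (EuclideanSpace ℝ (Fin n))}, IsCompact A → Convex ℝ A →
      (∀ f : EuclideanSpace ℝ (Fin n) →L[ℝ] ℝ, ∃ x ∈ A, 0 ≤ f x) → 0 ∈ A := by
    intro A hA hAc h
    by_contra h0
    obtain ⟨f, u, hf, hu⟩ := geometric_hahn_banach_closed_point hAc hA.isClosed h0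
    obtain ⟨x, hx, hfx⟩ := h f
    have := hf x hx
    rw [_root_.map_zero] at hu
    linarith
  have hckl : ∀ c : ℝ, l / k * (c * k) = c * l := fun c => by field_simp
  have hlk : 0 < l / k := by positivity
  refine ⟨hKc, hLc, hzero hK hKc fun f => ?_, hzero hL hLc fun f => ?_, l / k, hlk, ?_⟩
  · obtain ⟨x, hx, y, hy, c, hc, -, -, e, -⟩ := hsupp f
    exact ⟨x, hx, by rw [e]; positivity⟩
  · obtain ⟨x, hx, y, hy, c, hc, -, -, -, e⟩ := hsupp f
    exact ⟨y, hy, by rw [e]; positivity⟩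
  · refine Subset.antisymm (fun z hz => ?_) ?_
    · by_contra hzK
      obtain ⟨f, u, hf, hu⟩ := geometric_hahn_banach_closed_point (hKc.smul (l / k))
        (hK.smul (l / k)).isClosed hzK
      obtain ⟨x, hx, y, hy, c, hc, -, hymax, e, e'⟩ := hsupp f
      have h1 := hf _ ⟨x, hx, rfl⟩
      simp only [map_smul, smul_eq_mul] at h1
      rw [e, hckl] at h1
      linarith [hymax z hz]
    · rintro _ ⟨z, hz, rfl⟩
      by_contra hzL
      obtain ⟨f, u, hf, hu⟩ := geometric_hahn_banach_closed_point hLc hL.isClosed hzL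
      obtain ⟨x, hx, y, hy, c, hc, hxmax, -, e, e'⟩ := hsupp f
      have h1 := hf _ hy
      simp only [map_smul, smul_eq_mul] at hu
      have h2 := mul_le_mul_of_nonneg_left (hxmax z hz) hlk.le
      rw [e, hckl] at h2
      linarith

end IsPhiTwo

theorem brunnMinkowski_orlicz {n : ℕ} (hn : n ≠ 0) {φ : ℝ × ℝ → ℝ} (hφ : IsPhiTwo φ)
    {K L : Set (EuclideanSpace ℝ (Fin n))} (hK : IsCompact K) (hL : IsCompact L)
    (hKL : 0 < V K * V L) :
    IsCompact (orliczSum φ K L) ∧ 0 < V (orliczSum φ K L) ∧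
    1 ≥ φ ((V K / V (orliczSum φ K L)) ^ (1 / (n : ℝ)),
      (V L / V (orliczSum φ K L)) ^ (1 / (n : ℝ))) ∧
    (StrictConvexOn ℝ quadrant φ → (1 = φ ((V K / V (orliczSum φ K L)) ^ (1 / (n : ℝ)),
      (V L / V (orliczSum φ K L)) ^ (1 / (n : ℝ))) ↔ IsConvexZeroDilatates K L)) := by
  have hVK : 0 < V K := (V_nonneg K).lt_of_ne fun h => by simp [← h] at hKL
  have hVL : 0 < V L := (V_nonneg L).lt_of_ne fun h => by simp [← h] at hKL
  rw [Real.div_rpow (V_nonneg _) (V_nonneg _), Real.div_rpow (V_nonneg _) (V_nonneg _)]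
  exact ⟨hφ.isCompact_orliczSum hK hL, hφ.V_orliczSum_pos hn hK hL hVK hVL,
    hφ.map_radius_div_le_one hn hK hL hVK hVL, fun hs =>
    ⟨fun h => hφ.isConvexZeroDilatates_of_eq hs hn hK hL hVK hVL h.symm,
      fun h => (hφ.map_radius_div_eq_one hn hK hL hVK hVL h).symm⟩⟩

/-! ### The `L_p` sum -/

theorem strictConvexOn_powPhi {p : ℝ} (hp : 1 < p) : StrictConvexOn ℝ quadrant (powPhi p) := by
  have hsc := strictConvexOn_rpow hp
  refine ⟨convex_quadrant, fun z hz w hw hne a b ha hb hab => ?_⟩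
  have h1 := hsc.convexOn.2 hz.1 hw.1 ha.le hb.le hab
  have h2 := hsc.convexOn.2 hz.2 hw.2 ha.le hb.le hab
  simp only [powPhi, Prod.fst_add, Prod.snd_add, Prod.smul_fst, Prod.smul_snd, smul_eq_mul] at *
  by_cases he : z.1 = w.1
  · have h2' := hsc.2 hz.2 hw.2 (fun he2 => hne (Prod.ext he he2)) ha hb hab
    simp only [smul_eq_mul] at h2'
    linarith
  · have h1' := hsc.2 hz.1 hw.1 he ha hb hab
    simp only [smul_eq_mul] at h1'
    linarith

theorem isPhiTwo_powPhi {p : ℝ} (hp : 1 < p) : IsPhiTwo (powPhi p) where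
  convex := (strictConvexOn_powPhi hp).convexOn
  nonneg := fun _ hz => add_nonneg (Real.rpow_nonneg hz.1 _) (Real.rpow_nonneg hz.2 _)
  mono_left := fun x x' y hx hle _ => by
    simp only [powPhi]
    gcongr
  mono_right := fun x y y' _ hy hle => by
    simp only [powPhi]
    gcongr
  map_zero := by simp [powPhi, Real.zero_rpow (show p ≠ 0 by linarith)]
  map_left := by simp [powPhi, Real.zero_rpow (show p ≠ 0 by linarith)]
  map_right := by simp [powPhi, Real.zero_rpow (show p ≠ 0 by linarith)]

theorem isPhiOne_rpow {q : ℝ} (hq : 1 < q) : IsPhiOne fun s => s ^ q where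
  convex := (strictConvexOn_rpow hq).convexOn
  nonneg := fun _ hs => Real.rpow_nonneg hs _
  mono := fun _ hs _ _ hle => Real.rpow_le_rpow hs hle (by linarith)
  map_zero := Real.zero_rpow (by linarith)
  map_one := Real.one_rpow _

/-- The polar set of the `ℓ_p` unit ball is the `ℓ_{p'}` unit ball. -/
theorem mem_polarQuadrant_powPhi_iff {p q : ℝ} (hpq : p.HolderConjugate q) {z : ℝ × ℝ} :
    z ∈ polarQuadrant (powPhi p) ↔ z ∈ quadrant ∧ z.1 ^ q + z.2 ^ q ≤ 1 := by
  rw [(isPhiTwo_powPhi hpq.lt).mem_polarQuadrant_iff]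
  refine and_congr_right fun hz => ⟨fun h => ?_, fun h w hw hw1 => ?_⟩
  · by_contra hlt
    rw [not_le] at hlt
    set N := z.1 ^ q + z.2 ^ q with hN
    have hN0 : 0 < N := by linarith
    have hNp : 0 < N ^ (1 / p) := Real.rpow_pos_of_pos hN0 _
    have hpow : ∀ x : ℝ, 0 ≤ x → (x ^ (q - 1)) ^ p = x ^ q := fun x hx => by
      rw [← Real.rpow_mul hx]
      congr 1
      have := hpq.mul_eq_add
      linarith
    have hmul : ∀ x : ℝ, 0 ≤ x → x * x ^ (q - 1) = x ^ q := fun x hx => by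
      rcases hx.eq_or_lt with rfl | hx
      · rw [zero_mul, Real.zero_rpow hpq.symm.ne_zero]
      · rw [← Real.rpow_one_add' hx.le (by linarith [hpq.symm.pos])]
        congr 1; ring
    -- The equality case of Hölder's inequality.
    have := h (z.1 ^ (q - 1) / N ^ (1 / p), z.2 ^ (q - 1) / N ^ (1 / p))
      ⟨div_nonneg (Real.rpow_nonneg hz.1 _) hNp.le, div_nonneg (Real.rpow_nonneg hz.2 _) hNp.le⟩ (by
        simp only [powPhi]
        rw [Real.div_rpow (Real.rpow_nonneg hz.1 _) hNp.le,
          Real.div_rpow (Real.rpow_nonneg hz.2 _) hNp.le, hpow _ hz.1, hpow _ hz.2, ← add_div,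
          ← Real.rpow_mul hN0.le, one_div, inv_mul_cancel₀ hpq.ne_zero, Real.rpow_one, ← hN,
          div_self hN0.ne'])
    simp only at this
    rw [mul_div_assoc', mul_div_assoc', ← add_div, hmul _ hz.1, hmul _ hz.2, ← hN,
      div_le_one hNp] at this
    have hlt' : N ^ (1 / p) < N ^ (1 : ℝ) :=
      Real.rpow_lt_rpow_of_exponent_lt hlt ((div_lt_one hpq.pos).2 hpq.lt)
    rw [Real.rpow_one] at hlt'
    linarith
  · have h1 := Real.young_inequality_of_nonneg hw.1 hz.1 hpq
    have h2 := Real.young_inequality_of_nonneg hw.2 hz.2 hpq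
    have e := hpq.inv_add_inv_eq_one
    simp only [powPhi] at hw1
    have h3 := mul_le_mul_of_nonneg_left hw1 (inv_nonneg.2 hpq.nonneg)
    have h4 := mul_le_mul_of_nonneg_left h (inv_nonneg.2 hpq.symm.nonneg)
    simp only [div_eq_mul_inv] at h1 h2
    nlinarith

theorem represents_powPhi {p q : ℝ} (hpq : p.HolderConjugate q) :
    Represents (powPhi p) (fun s => s ^ q) fun s => s ^ q := by
  refine ⟨isPhiOne_rpow hpq.symm.lt, isPhiOne_rpow hpq.symm.lt, ?_⟩
  ext z
  constructor
  · intro hz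
    have h1 := (isPhiTwo_powPhi hpq.lt).le_one_of_mem_polarQuadrant hz
    exact ⟨⟨⟨hz.2.1, h1.1⟩, ⟨hz.2.2, h1.2⟩⟩, ((mem_polarQuadrant_powPhi_iff hpq).1 hz).2⟩
  · rintro ⟨⟨hz1, hz2⟩, hz⟩
    exact (mem_polarQuadrant_powPhi_iff hpq).2 ⟨⟨hz1.1, hz2.1⟩, hz⟩

theorem orliczSum_powPhi {p : ℝ} (hp : 1 < p) (K L : Set (EuclideanSpace ℝ (Fin n))) :
    orliczSum (powPhi p) K L = lpSum p K L := by
  have hpq := Real.HolderConjugate.conjExponent hp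
  have hψ := isPhiOne_rpow hpq.symm.lt
  have hinv : ∀ t ∈ Icc (0 : ℝ) 1, hatInv (fun s => s ^ p.conjExponent) t =
      t ^ (1 / p.conjExponent) := fun t ht => by
    obtain ⟨h1, h2⟩ := hψ.hatInv_spec ht
    have h0 := hψ.tau_spec.1.trans h1.1
    rw [one_div]
    conv_rhs => rw [← h2]
    rw [Real.rpow_rpow_inv h0 hpq.symm.ne_zero]
  rw [(isPhiTwo_powPhi hp).orliczSum_eq, ← IsPhiTwo.range_hatInv_eq_upperArc (represents_powPhi hpq)]
  ext z
  simp only [lpSum, mem_ofPred_eq, exists_mem_image]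
  constructor
  · rintro ⟨t, ht, x, hx, y, hy, rfl⟩
    exact ⟨x, hx, y, hy, t, ht, by
      rw [hinv t ht, hinv (1 - t) ⟨by linarith [ht.2], by linarith [ht.1]⟩]⟩
  · rintro ⟨x, hx, y, hy, t, ht, rfl⟩
    exact ⟨t, ht, x, hx, y, hy, by
      rw [hinv t ht, hinv (1 - t) ⟨by linarith [ht.2], by linarith [ht.1]⟩]⟩

theorem subset_lpSum {p : ℝ} (hp : 1 < p) {K L : Set (EuclideanSpace ℝ (Fin n))}
    (hK : K.Nonempty) (hL : L.Nonempty) : K ⊆ lpSum p K L ∧ L ⊆ lpSum p K L := by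
  have hq : p.conjExponent⁻¹ ≠ 0 :=
    inv_ne_zero (Real.HolderConjugate.conjExponent hp).symm.ne_zero
  obtain ⟨x, hx⟩ := hK
  obtain ⟨y, hy⟩ := hL
  exact ⟨fun z hz => ⟨z, hz, y, hy, 0, ⟨le_rfl, zero_le_one⟩, by simp [Real.zero_rpow hq]⟩,
    fun z hz => ⟨x, hx, z, hz, 1, ⟨zero_le_one, le_rfl⟩, by simp [Real.zero_rpow hq]⟩⟩

end OrliczBM

theorem corollary7p6 (n : ℕ) (hn : 2 ≤ n) :
    (∀ φ : ℝ × ℝ → ℝ, OrliczBM.IsPhiTwo φ →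
      ∀ K L : Set (EuclideanSpace ℝ (Fin n)), IsCompact K → IsCompact L →
        0 < OrliczBM.V K * OrliczBM.V L →
        IsCompact (OrliczBM.orliczSum φ K L) ∧
        0 < OrliczBM.V (OrliczBM.orliczSum φ K L) ∧
        1 ≥ φ ((OrliczBM.V K / OrliczBM.V (OrliczBM.orliczSum φ K L)) ^ (1 / (n : ℝ)),
          (OrliczBM.V L / OrliczBM.V (OrliczBM.orliczSum φ K L)) ^ (1 / (n : ℝ))) ∧
        (StrictConvexOn ℝ OrliczBM.quadrant φ →
          (1 = φ ((OrliczBM.V K / OrliczBM.V (OrliczBM.orliczSum φ K L)) ^ (1 / (n : ℝ)),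
            (OrliczBM.V L / OrliczBM.V (OrliczBM.orliczSum φ K L)) ^ (1 / (n : ℝ))) ↔
          OrliczBM.IsConvexZeroDilatates K L))) ∧
    (∀ p : ℝ, 1 < p →
      OrliczBM.IsPhiTwo (OrliczBM.powPhi p) ∧
      ∀ K L : Set (EuclideanSpace ℝ (Fin n)), IsCompact K → IsCompact L →
        K.Nonempty → L.Nonempty →
        OrliczBM.orliczSum (OrliczBM.powPhi p) K L = OrliczBM.lpSum p K L ∧
        OrliczBM.V (OrliczBM.lpSum p K L) ^ (p / (n : ℝ)) ≥
          OrliczBM.V K ^ (p / (n : ℝ)) + OrliczBM.V L ^ (p / (n : ℝ)) ∧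
        (0 < OrliczBM.V K * OrliczBM.V L →
          (OrliczBM.V (OrliczBM.lpSum p K L) ^ (p / (n : ℝ)) =
            OrliczBM.V K ^ (p / (n : ℝ)) + OrliczBM.V L ^ (p / (n : ℝ)) ↔
          OrliczBM.IsConvexZeroDilatates K L))) := by
  have hn0 : n ≠ 0 := by omega
  refine ⟨fun φ hφ K L hK hL hKL => OrliczBM.brunnMinkowski_orlicz hn0 hφ hK hL hKL, fun p hp => ?_⟩
  have hφ := OrliczBM.isPhiTwo_powPhi hp
  refine ⟨hφ, fun K L hK hL hK' hL' => ⟨OrliczBM.orliczSum_powPhi hp K L, ?_⟩⟩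
  have hpn : p / (n : ℝ) ≠ 0 := by positivity
  have hpn0 : 0 ≤ p / (n : ℝ) := by positivity
  have hSc : IsCompact (OrliczBM.lpSum p K L) := by
    rw [← OrliczBM.orliczSum_powPhi hp]
    exact hφ.isCompact_orliczSum hK hL
  have hmain : 0 < OrliczBM.V K * OrliczBM.V L → _ := OrliczBM.brunnMinkowski_orlicz hn0 hφ hK hL
  rw [OrliczBM.orliczSum_powPhi hp] at hmain
  have hphi : 0 < OrliczBM.V (OrliczBM.lpSum p K L) → OrliczBM.powPhi p
      ((OrliczBM.V K / OrliczBM.V (OrliczBM.lpSum p K L)) ^ (1 / (n : ℝ)),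
        (OrliczBM.V L / OrliczBM.V (OrliczBM.lpSum p K L)) ^ (1 / (n : ℝ))) =
      (OrliczBM.V K ^ (p / (n : ℝ)) + OrliczBM.V L ^ (p / (n : ℝ))) /
        OrliczBM.V (OrliczBM.lpSum p K L) ^ (p / (n : ℝ)) := fun _ => by
    have hV := OrliczBM.V_nonneg (n := n)
    simp only [OrliczBM.powPhi]
    rw [← Real.rpow_mul (div_nonneg (hV _) (hV _)), ← Real.rpow_mul (div_nonneg (hV _) (hV _)),
      one_div_mul_eq_div, Real.div_rpow (hV _) (hV _), Real.div_rpow (hV _) (hV _), ← add_div]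
  constructor
  · obtain ⟨hKS, hLS⟩ := OrliczBM.subset_lpSum hp hK' hL'
    rcases (OrliczBM.V_nonneg K).eq_or_lt with h0 | hVK
    · rw [← h0, Real.zero_rpow hpn, zero_add]
      exact Real.rpow_le_rpow (OrliczBM.V_nonneg _) (OrliczBM.V_mono hSc hLS) hpn0
    rcases (OrliczBM.V_nonneg L).eq_or_lt with h0 | hVL
    · rw [← h0, Real.zero_rpow hpn, add_zero]
      exact Real.rpow_le_rpow (OrliczBM.V_nonneg _) (OrliczBM.V_mono hSc hKS) hpn0
    obtain ⟨-, hpos, hle, -⟩ := hmain (mul_pos hVK hVL)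
    rwa [hphi hpos, ge_iff_le, div_le_one (Real.rpow_pos_of_pos hpos _)] at hle
  · intro hKL
    obtain ⟨-, hpos, -, hiff⟩ := hmain hKL
    rw [← hiff (OrliczBM.strictConvexOn_powPhi hp), hphi hpos, eq_comm (a := (1 : ℝ)),
      div_eq_one_iff_eq (Real.rpow_pos_of_pos hpos _).ne', eq_comm]
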